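/- Let $\theta,\gamma,\delta,M,N,S,P$ be smooth real functions of $\mu=(\mu_1,\mu_2)$ on an open neighbourhood of $0\in\mathbb R^2$, and consider the planar system $$\dot\xi_1=\xi_1\,g_1,\quad g_1=\mu_1-\theta(\mu)\xi_1+\gamma(\mu)\xi_2-M(\mu)\xi_1\xi_2+N(\mu)\xi_1^2,$$ $$\dot\xi_2=\xi_2\,g_2,\quad g_2=\mu_2-\delta(\mu)\xi_1+\xi_2+S(\mu)\xi_1^2+P(\mu)\xi_2^2.$$ Write $\theta=\theta(0)$, $\gamma=\gamma(0)$, $\delta=\delta(0)$ and assume $\theta\delta\neq0$ and $\theta-\gamma\delta\neq0$. Then, for all sufficiently small $|\mu|$: (i) There are smooth functions $e(\mu)\in\mathbb R$ and $E_3(\mu)\in\mathbb R^2$ such that $\xi_1=e(\mu)$ is the unique solution near $0$ of $\mu_1-\theta(\mu)\xi_1+N(\mu)\xi_1^2=0$, which gives the equilibrium $E_1(\mu)=(e(\mu),0)$, and $E_3(\mu)$ is the unique solution near $(0,0)$ of $g_1=g_2=0$. The set $$T_1=\{\mu : \text{the second coordinate of }E_3(\mu)\text{ is }0,\ \mu_1/\theta>0\}$$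 is the smooth curve $\mu_2=h(\mu_1)$, $\mu_1/\theta>0$, where $h$ is smooth near $0$ and $h(\mu_1)=\frac{\delta}{\theta}\mu_1+O(\mu_1^2)$. (ii) At each $\mu\in T_1$ the points $E_3$ and $E_1$ coincide, with $e(\mu)>0$, and the linearization of the system at this point has the eigenvalues $0$ and $\lambda\ne0$, where $\lambda=-\mu_1+O(\mu_1^2)$. (iii) $T_1$ is a transcritical bifurcation curve. Precisely, let $\mu^0\in T_1$, fix $\mu_1=\mu^0_1$, let $\mu_2$ be the bifurcation parameter, write $f$ for the right-hand side of the system, $\xi^0=E_1(\mu^0)$ and $A=D_\xi f(\xi^0,\mu^0)$. Then Sotomayor's conditions hold: $f(\xi^0,\mu^0)=0$, $0$ is a simple eigenvalue of $A$ and the other eigenvalue is not on the imaginary axis, and there are $v\neq0$, $w\neq0$ with $Av=0$, $w^TA=0$ and $$w^Tf_{\mu_2}=0,\qquad w^T\,(D_\xi f_{\mu_2})\,v\neq0,\qquad w^T\,D_\xi^2f\,(v,v)\neq0\qquad\text{at }(\xi^0,\mu^0).$$ Moreover, for $\mu_2$ near $\mu_2^0$ the equilibria near $\xi^0$ are exactly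 $E_1(\mu^0_1,\mu_2)$ and $E_3(\mu^0_1,\mu_2)$; these two smooth branches coincide only at $\mu_2=\mu_2^0$, where they have different derivatives with respect to $\mu_2$; for $\mu_2\neq\mu^0_2$ both equilibria are hyperbolic, their numbers of eigenvalues with negative real part differ by one, and these two numbers are interchanged between the branches when $\mu_2$ passes through $\mu^0_2$. -/

import Mathlib

open scoped ContDiff

noncomputable section

namespace KolmogorovTranscritical

/-! ### One-parameter families of vector fields `x' = F s x` on a finite-dimensional space -/

section Bifurcation

variable {E : Type*} [NormedAddCommGroup E] [NormedSpace ℝ E] [FiniteDimensional ℝ E]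

/-- The complex eigenvalues of the linearization of the vector field `f` at `x`,
counted with algebraic multiplicity. -/
def eigenvaluesAt (f : E → E) (x : E) : Multiset ℂ :=
  ((LinearMap.charpoly (fderiv ℝ f x : E →ₗ[ℝ] E)).map (algebraMap ℝ ℂ)).roots

/-- No eigenvalue of the linearization lies on the imaginary axis. -/
def IsHyperbolicAt (f : E → E) (x : E) : Prop :=
  ∀ z ∈ eigenvaluesAt f x, z.re ≠ 0

/-- The number of eigenvalues with negative real part. -/
def stableIndex (f : E → E) (x : E) : ℕ :=
  (eigenvaluesAt f x).countP (fun z => z.re < 0)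

/-- The family `x' = F s x` has a transcritical bifurcation at `(x₀, s₀)`, with branches of
equilibria `p` and `q`: near `(x₀, s₀)` the equilibria are exactly the points of two smooth branches
that cross transversally at `(x₀, s₀)` and nowhere else, all equilibria other than `x₀` at `s₀` are
hyperbolic, and the two branches exchange their stability (their numbers of eigenvalues with
negative real part, which differ by one) as `s` passes through `s₀`. -/
structure IsTranscritical (F : ℝ → E → E) (p q : ℝ → E) (x₀ : E) (s₀ : ℝ) : Prop where
  left_base : p s₀ = x₀
  right_base : q s₀ = x₀
  transversal : deriv p s₀ ≠ deriv q s₀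
  local_picture : ∃ ρ > 0, ∃ r > 0,
    ContDiffOn ℝ ∞ p (Set.Ioo (s₀ - ρ) (s₀ + ρ)) ∧
    ContDiffOn ℝ ∞ q (Set.Ioo (s₀ - ρ) (s₀ + ρ)) ∧
    (∀ s ∈ Set.Ioo (s₀ - ρ) (s₀ + ρ),
      p s ∈ Metric.ball x₀ r ∧ q s ∈ Metric.ball x₀ r ∧
      (∀ x ∈ Metric.ball x₀ r, F s x = 0 ↔ x = p s ∨ x = q s) ∧
      (s ≠ s₀ → p s ≠ q s ∧ IsHyperbolicAt (F s) (p s) ∧ IsHyperbolicAt (F s) (q s))) ∧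
    ∃ k l : ℕ, (k = l + 1 ∨ l = k + 1) ∧
      (∀ s ∈ Set.Ioo (s₀ - ρ) s₀, stableIndex (F s) (p s) = k ∧ stableIndex (F s) (q s) = l) ∧
      (∀ s ∈ Set.Ioo s₀ (s₀ + ρ), stableIndex (F s) (p s) = l ∧ stableIndex (F s) (q s) = k)

/-- Sotomayor's conditions for a transcritical bifurcation of `x' = F s x` at `(x₀, s₀)`: `x₀` is
an equilibrium whose linearization `A` has `0` as a simple eigenvalue and no other eigenvalue on the
imaginary axis; with `A v = 0` and `wᵀ A = 0` (the row vector `wᵀ` is a linear functional) one has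
`wᵀ F_s = 0`, `wᵀ (D F_s) v ≠ 0` and `wᵀ D²F (v, v) ≠ 0`. -/
def SotomayorTranscritical (F : ℝ → E → E) (x₀ : E) (s₀ : ℝ) : Prop :=
  F s₀ x₀ = 0 ∧
  (eigenvaluesAt (F s₀) x₀).count 0 = 1 ∧
  (∀ z ∈ eigenvaluesAt (F s₀) x₀, z ≠ 0 → z.re ≠ 0) ∧
  ∃ (v : E) (w : E →L[ℝ] ℝ), v ≠ 0 ∧ w ≠ 0 ∧
    fderiv ℝ (F s₀) x₀ v = 0 ∧
    w.comp (fderiv ℝ (F s₀) x₀) = 0 ∧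
    w (deriv (fun s => F s x₀) s₀) = 0 ∧
    w (deriv (fun s => fderiv ℝ (F s) x₀ v) s₀) ≠ 0 ∧
    w (fderiv ℝ (fun x => fderiv ℝ (F s₀) x v) x₀ v) ≠ 0

end Bifurcation

/-! ### The Kolmogorov system -/

/-- The coefficients of the system, as functions of the parameter `μ = (μ₁, μ₂)`. -/
structure Coeffs where
  θ : ℝ × ℝ → ℝ
  γ : ℝ × ℝ → ℝ
  δ : ℝ × ℝ → ℝ
  M : ℝ × ℝ → ℝ
  N : ℝ × ℝ → ℝ
  S : ℝ × ℝ → ℝ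
  P : ℝ × ℝ → ℝ

namespace Coeffs

variable (c : Coeffs)

/-- All coefficients are smooth on `U`. -/
def SmoothOn (U : Set (ℝ × ℝ)) : Prop :=
  ContDiffOn ℝ ∞ c.θ U ∧ ContDiffOn ℝ ∞ c.γ U ∧ ContDiffOn ℝ ∞ c.δ U ∧
  ContDiffOn ℝ ∞ c.M U ∧ ContDiffOn ℝ ∞ c.N U ∧ ContDiffOn ℝ ∞ c.S U ∧ ContDiffOn ℝ ∞ c.P U

/-- `μ₁ - θ ξ₁ + γ ξ₂ - M ξ₁ ξ₂ + N ξ₁²`. -/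
def g₁ (μ ξ : ℝ × ℝ) : ℝ :=
  μ.1 - c.θ μ * ξ.1 + c.γ μ * ξ.2 - c.M μ * ξ.1 * ξ.2 + c.N μ * ξ.1 ^ 2

/-- `μ₂ - δ ξ₁ + ξ₂ + S ξ₁² + P ξ₂²`. -/
def g₂ (μ ξ : ℝ × ℝ) : ℝ :=
  μ.2 - c.δ μ * ξ.1 + ξ.2 + c.S μ * ξ.1 ^ 2 + c.P μ * ξ.2 ^ 2

/-- The right-hand side of the system: `ξ₁' = ξ₁ g₁`, `ξ₂' = ξ₂ g₂`. -/
def field (μ ξ : ℝ × ℝ) : ℝ × ℝ :=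
  (ξ.1 * c.g₁ μ ξ, ξ.2 * c.g₂ μ ξ)

/-- `e μ` is the first coordinate of the equilibrium `E₁(μ) = (e μ, 0)`: for `|μ| < ε` it is the
only solution in `(-r, r)` of `μ₁ - θ ξ₁ + N ξ₁² = 0`, and it is smooth in `μ`. -/
def IsE₁ (e : ℝ × ℝ → ℝ) (ε r : ℝ) : Prop :=
  ContDiffOn ℝ ∞ e (Metric.ball 0 ε) ∧
  ∀ μ ∈ Metric.ball (0 : ℝ × ℝ) ε, e μ ∈ Set.Ioo (-r) r ∧
    ∀ x ∈ Set.Ioo (-r) r, μ.1 - c.θ μ * x + c.N μ * x ^ 2 = 0 ↔ x = e μ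

/-- `E₃ μ` is the fourth equilibrium: for `|μ| < ε` it is the only common zero of `g₁ μ` and
`g₂ μ` in the ball of radius `r` about the origin, and it is smooth in `μ`. -/
def IsE₃ (E₃ : ℝ × ℝ → ℝ × ℝ) (ε r : ℝ) : Prop :=
  ContDiffOn ℝ ∞ E₃ (Metric.ball 0 ε) ∧
  ∀ μ ∈ Metric.ball (0 : ℝ × ℝ) ε, E₃ μ ∈ Metric.ball (0 : ℝ × ℝ) r ∧
    ∀ ξ ∈ Metric.ball (0 : ℝ × ℝ) r, (c.g₁ μ ξ = 0 ∧ c.g₂ μ ξ = 0) ↔ ξ = E₃ μ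

/-- The curve `T₁` for `|μ| < ε`: the second coordinate of `E₃` vanishes and `μ₁ / θ(0) > 0`. -/
def T₁ (E₃ : ℝ × ℝ → ℝ × ℝ) (ε : ℝ) : Set (ℝ × ℝ) :=
  {μ | μ ∈ Metric.ball (0 : ℝ × ℝ) ε ∧ (E₃ μ).2 = 0 ∧ 0 < μ.1 / c.θ 0}

end Coeffs

end KolmogorovTranscritical

end

/-!
The equilibrium `E₁`, the equilibrium `E₃` and the curve on which they meet are implicit functions
of `g₁(ξ₁, 0) = 0`, of `g₁ = g₂ = 0`, and of `g₁(ξ₁, 0) = g₂(ξ₁, 0) = 0` solved for `(μ₂, ξ₁)`.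
Where they meet, `ξ₂ = 0` and both rates vanish, so one eigenvalue is zero and the other is
`ξ₁ ∂g₁/∂ξ₁`. As `μ₂` crosses the curve, the determinant of the linearization is
`ξ₁ (∂g₁/∂ξ₁) g₂` along `E₁` and `ξ₁ ξ₂` times the Jacobian of `(g₁, g₂)` along `E₃`; by
Cramer's rule their derivatives are nonzero and opposite. The trace keeps its nonzero sign, hence
one branch loses the stable direction that the other gains. All that Sotomayor's conditions and
transversality require is that certain minors of the derivative of `(g₁, g₂)` in `(μ₂, ξ)` do not
vanish, which holds near the origin because it holds there.
-/

namespace KolmogorovTranscritical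

open Filter
open scoped ContDiff Topology

/-! ### Smooth implicit functions -/

theorem eventually_forall_ball {α : Type*} [PseudoMetricSpace α] {p : α → Prop} {x : α}
    (h : ∀ᶠ y in 𝓝 x, p y) : ∀ᶠ ε in 𝓝[>] (0 : ℝ), ∀ y ∈ Metric.ball x ε, p y :=
  (((tendsto_closedBall_smallSets x).mono_left nhdsWithin_le_nhds).eventually
    (eventually_smallSets_forall.2 h)).mono
      fun _ hε y hy => hε y (Metric.ball_subset_closedBall hy)

section SmoothImplicit

variable {X Y : Type*} [NormedAddCommGroup X] [NormedSpace ℝ X] [NormedAddCommGroup Y]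
  [NormedSpace ℝ Y]

/-- `φ` is a smooth implicit function of `f` at `u`: near `u`, the zero set of `f` is the graph of
`φ`, which is smooth on a neighbourhood of `u.1`. -/
structure IsSmoothImplicitAt {Z : Type*} [Zero Z] (f : X × Y → Z) (φ : X → Y) (u : X × Y) :
    Prop where
  base : φ u.1 = u.2
  contDiffAt : ∀ᶠ x in 𝓝 u.1, ContDiffAt ℝ ∞ φ x
  eq_zero_iff : ∀ᶠ v in 𝓝 u, f v = 0 ↔ v.2 = φ v.1

/-- A version of `IsSmoothImplicitAt` with explicit radii: for `x` in the ball of radius `ε` about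
`u.1`, `φ x` is the only zero of `f (x, ·)` in the ball of radius `r` about `u.2`. -/
def IsSmoothImplicitOn {Z : Type*} [Zero Z] (f : X × Y → Z) (φ : X → Y) (u : X × Y) (ε r : ℝ) :
    Prop :=
  ContDiffOn ℝ ∞ φ (Metric.ball u.1 ε) ∧
    ∀ x ∈ Metric.ball u.1 ε, φ x ∈ Metric.ball u.2 r ∧
      ∀ y ∈ Metric.ball u.2 r, f (x, y) = 0 ↔ y = φ x

section Existence

variable {Z : Type*} [NormedAddCommGroup Z] [NormedSpace ℝ Z]

theorem eventually_isInvertible_inr [CompleteSpace Y] {f : X × Y → Z} {u : X × Y}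
    (hf : ContDiffAt ℝ 1 f u) (hu : (fderiv ℝ f u ∘L .inr ℝ X Y).IsInvertible) :
    ∀ᶠ v in 𝓝 u, (fderiv ℝ f v ∘L .inr ℝ X Y).IsInvertible := by
  obtain ⟨L, hL⟩ := hu
  have hcont : ContinuousAt (fun v => fderiv ℝ f v ∘L .inr ℝ X Y) u :=
    (hf.continuousAt_fderiv one_ne_zero).clm_comp continuousAt_const
  have hopen : ∀ᶠ A : Y →L[ℝ] Z in 𝓝 L, A.IsInvertible := ContinuousLinearEquiv.nhds L
  rw [hL] at hopen
  exact hcont.eventually hopen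

theorem exists_isSmoothImplicitAt [CompleteSpace X] [CompleteSpace Y] [CompleteSpace Z]
    {f : X × Y → Z} {u : X × Y} (hf : ∀ᶠ v in 𝓝 u, ContDiffAt ℝ ∞ f v) (hfu : f u = 0)
    (hinv : (fderiv ℝ f u ∘L .inr ℝ X Y).IsInvertible) :
    ∃ φ, IsSmoothImplicitAt f φ u := by
  have hne : (∞ : WithTop ℕ∞) ≠ 0 := by simp
  have hsmooth := hf.self_of_nhds
  set φ := hsmooth.implicitFunction hne hinv
  have base : φ u.1 = u.2 := hsmooth.implicitFunction_apply_self hne hinv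
  have eq_iff : ∀ᶠ v in 𝓝 u, f v = 0 ↔ φ v.1 = v.2 :=
    hfu ▸ hsmooth.eventually_apply_eq_iff_implicitFunction hne hinv
  have hcont : ∀ᶠ x in 𝓝 u.1, ContinuousAt φ x :=
    (((hsmooth.contDiffAt_implicitFunction hne hinv).of_le
      (by simp : (1 : WithTop ℕ∞) ≤ ∞)).eventually (by simp)).mono fun x hx => hx.continuousAt
  have hgraph : Tendsto (fun x => (x, φ x)) (𝓝 u.1) (𝓝 u) := by
    simpa [ContinuousAt, base] using
      (continuousAt_id.prodMk hcont.self_of_nhds : ContinuousAt (fun x => (x, φ x)) u.1)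
  refine ⟨φ, base, ?_, eq_iff.mono fun v hv => hv.trans eq_comm⟩
  -- At a nearby point `(x, φ x)` the implicit function theorem applies again; by uniqueness the
  -- function it yields is `φ`, which is therefore smooth at `x` as well.
  filter_upwards [hgraph.eventually hf, hgraph.eventually eq_iff.eventually_nhds, hcont,
    hgraph.eventually (eventually_isInvertible_inr (hsmooth.of_le (by simp)) hinv)]
    with x hfx hx hφx hinvx
  have hfx₀ : f (x, φ x) = 0 := hx.self_of_nhds.2 rfl
  have hgraphx : Tendsto (fun y => (y, φ y)) (𝓝 x) (𝓝 (x, φ x)) := continuousAt_id.prodMk hφx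
  refine (hfx.contDiffAt_implicitFunction hne hinvx).congr_of_eventuallyEq ?_
  filter_upwards [hgraphx.eventually hx, hgraphx.eventually
    (hfx.eventually_apply_eq_iff_implicitFunction hne hinvx)] with y hy hψ
  exact (hψ.1 ((hy.2 rfl).trans hfx₀.symm)).symm

end Existence

theorem isInvertible_of_injective [FiniteDimensional ℝ Y] {A : Y →L[ℝ] Y}
    (hA : Function.Injective A) : A.IsInvertible :=
  ⟨(LinearEquiv.ofInjectiveEndo (A : Y →ₗ[ℝ] Y) hA).toContinuousLinearEquiv, by ext; rfl⟩

namespace IsSmoothImplicitAt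

variable {Z : Type*} [Zero Z] {f : X × Y → Z} {φ : X → Y} {u : X × Y}

theorem tendsto_graph (h : IsSmoothImplicitAt f φ u) :
    Tendsto (fun x => (x, φ x)) (𝓝 u.1) (𝓝 u) := by
  simpa [ContinuousAt, h.base] using
    (continuousAt_id.prodMk h.contDiffAt.self_of_nhds.continuousAt :
      ContinuousAt (fun x => (x, φ x)) u.1)

theorem eventually_apply_graph (h : IsSmoothImplicitAt f φ u) :
    ∀ᶠ x in 𝓝 u.1, f (x, φ x) = 0 :=
  (h.tendsto_graph.eventually h.eq_zero_iff).mono fun _ hx => hx.2 rfl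

theorem eventually_isSmoothImplicitAt (h : IsSmoothImplicitAt f φ u) :
    ∀ᶠ x in 𝓝 u.1, IsSmoothImplicitAt f φ (x, φ x) := by
  filter_upwards [h.contDiffAt.eventually_nhds,
    h.tendsto_graph.eventually h.eq_zero_iff.eventually_nhds] with x hsmooth hiff
  exact ⟨rfl, hsmooth, hiff⟩

theorem comp_left {W : Type*} [NormedAddCommGroup W] [NormedSpace ℝ W] {a : W → X} {w : W} {y : Y}
    (h : IsSmoothImplicitAt f φ (a w, y)) (ha : ContDiff ℝ ∞ a) :
    IsSmoothImplicitAt (fun v : W × Y => f (a v.1, v.2)) (φ ∘ a) (w, y) where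
  base := h.base
  contDiffAt := (ha.continuous.continuousAt.eventually h.contDiffAt).mono
    fun _ hx => hx.comp _ ha.contDiffAt
  eq_zero_iff :=
    have hcont : Continuous fun v : W × Y => (a v.1, v.2) := by
      have := ha.continuous
      fun_prop
    (hcont.tendsto (w, y)).eventually h.eq_zero_iff

theorem eventually_isSmoothImplicitOn (h : IsSmoothImplicitAt f φ u) :
    ∀ᶠ r in 𝓝[>] (0 : ℝ), ∀ᶠ ε in 𝓝[>] (0 : ℝ), IsSmoothImplicitOn f φ u ε r := by
  filter_upwards [eventually_forall_ball h.eq_zero_iff, self_mem_nhdsWithin] with r hr hr₀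
  have hφ : ∀ᶠ x in 𝓝 u.1, φ x ∈ Metric.ball u.2 r :=
    h.contDiffAt.self_of_nhds.continuousAt.eventually (h.base ▸ Metric.ball_mem_nhds u.2 hr₀)
  filter_upwards [eventually_forall_ball h.contDiffAt, eventually_forall_ball hφ,
    Ioo_mem_nhdsGT hr₀] with ε hsmooth hmaps hε
  refine ⟨fun x hx => (hsmooth x hx).contDiffWithinAt, fun x hx => ⟨hmaps x hx, fun y hy => ?_⟩⟩
  exact hr (x, y) (ball_prod_same u.1 u.2 r ▸ ⟨Metric.ball_subset_ball hε.2.le hx, hy⟩)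

theorem apply_one_deriv {W : Type*} [NormedAddCommGroup W] [NormedSpace ℝ W] {f : ℝ × Y → W}
    {f' : ℝ × Y →L[ℝ] W} {φ : ℝ → Y} {u : ℝ × Y} (h : IsSmoothImplicitAt f φ u)
    (hf : HasFDerivAt f f' u) :
    f' (1, deriv φ u.1) = 0 := by
  have hφ : HasDerivAt φ (deriv φ u.1) u.1 :=
    (h.contDiffAt.self_of_nhds.differentiableAt (by simp)).hasDerivAt
  have hgraph : HasDerivAt (fun s => f (s, φ s)) (f' (1, deriv φ u.1)) u.1 :=
    HasFDerivAt.comp_hasDerivAt (f := fun s => (s, φ s)) u.1 (by rwa [h.base])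
      ((hasDerivAt_id u.1).prodMk hφ)
  have hzero : (fun s => f (s, φ s)) =ᶠ[𝓝 u.1] 0 := h.eventually_apply_graph
  exact hgraph.unique ((hasDerivAt_const u.1 0).congr_of_eventuallyEq hzero)

end IsSmoothImplicitAt

end SmoothImplicit

/-! ### Stability of planar equilibria -/

section ConjugatePair

variable {z w : ℂ} {p : ℝ}

theorem re_mul_re_neg (hsum : (z + w).im = 0) (hprod : z * w = p) (hp : p < 0) :
    z.re * w.re < 0 := by
  obtain ⟨hre, -⟩ := Complex.ext_iff.1 hprod
  rw [Complex.add_im, ← eq_neg_iff_add_eq_zero] at hsum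
  rw [Complex.mul_re, Complex.ofReal_re, hsum] at hre
  nlinarith [mul_self_nonneg w.im]

theorem re_mul_re_pos (hsum : (z + w).im = 0) (hsum_re : (z + w).re ≠ 0) (hprod : z * w = p)
    (hp : 0 < p) : 0 < z.re * w.re := by
  obtain ⟨hre, him⟩ := Complex.ext_iff.1 hprod
  rw [Complex.add_re] at hsum_re
  rw [Complex.add_im, ← eq_neg_iff_add_eq_zero] at hsum
  rw [Complex.mul_re, Complex.ofReal_re] at hre
  rw [Complex.mul_im, Complex.ofReal_im, hsum] at him
  -- Either both numbers are real or they are conjugate.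
  obtain him₀ | hconj : w.im = 0 ∨ z.re = w.re := by
    rw [← sub_eq_zero (a := z.re), ← mul_eq_zero]
    linarith
  · rw [him₀] at hre
    linarith
  · rw [hconj] at hsum_re ⊢
    exact mul_self_pos.2 fun h => hsum_re (by rw [h, add_zero])

end ConjugatePair

section PlanarLinearization

variable {E : Type*} [NormedAddCommGroup E] [NormedSpace ℝ E] [FiniteDimensional ℝ E]
  (hE : Module.finrank ℝ E = 2) {f : E → E} {x : E} {z w : ℂ}

include hE in
theorem eigenvaluesAt_eq_pair_iff :
    eigenvaluesAt f x = {z, w} ↔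
      z + w = (LinearMap.trace ℝ E (fderiv ℝ f x) : ℝ) ∧ z * w = ((fderiv ℝ f x).det : ℝ) := by
  have b := Module.finBasisOfFinrankEq ℝ E hE
  have hpoly : ((LinearMap.charpoly (fderiv ℝ f x : E →ₗ[ℝ] E)).map (algebraMap ℝ ℂ)) =
      .C 1 * .X ^ 2 + .C (-(LinearMap.trace ℝ E (fderiv ℝ f x) : ℂ)) * .X +
        .C ((fderiv ℝ f x).det : ℂ) := by
    rw [← LinearMap.charpoly_toMatrix _ b, Matrix.charpoly_fin_two,
      ← LinearMap.trace_eq_matrix_trace, LinearMap.det_toMatrix, ContinuousLinearMap.det]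
    simp [sub_eq_add_neg]
  rw [eigenvaluesAt, hpoly, Polynomial.roots_quadratic_eq_pair_iff_of_ne_zero one_ne_zero]
  simp only [neg_mul, one_mul, neg_inj, eq_comm]

include hE in
theorem exists_eigenvaluesAt_eq_pair (f : E → E) (x : E) : ∃ z w, eigenvaluesAt f x = {z, w} := by
  obtain ⟨q, hq⟩ := IsAlgClosed.exists_pow_nat_eq
    ((LinearMap.trace ℝ E (fderiv ℝ f x) : ℂ) ^ 2 - 4 * (fderiv ℝ f x).det) two_pos
  refine ⟨(LinearMap.trace ℝ E (fderiv ℝ f x) + q) / 2,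
    (LinearMap.trace ℝ E (fderiv ℝ f x) - q) / 2, (eigenvaluesAt_eq_pair_iff hE).2 ⟨by ring, ?_⟩⟩
  linear_combination -hq / 4

theorem stableIndex_of_eigenvaluesAt_eq_pair (h : eigenvaluesAt f x = {z, w}) :
    stableIndex f x = (if z.re < 0 then 1 else 0) + if w.re < 0 then 1 else 0 := by
  rw [stableIndex, h, Multiset.insert_eq_cons, ← Multiset.cons_zero w, Multiset.countP_cons,
    Multiset.countP_cons, Multiset.countP_zero, zero_add, add_comm]

include hE in
theorem isHyperbolicAt_of_det_ne_zero (hdet : (fderiv ℝ f x).det ≠ 0)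
    (htrace : LinearMap.trace ℝ E (fderiv ℝ f x) ≠ 0) : IsHyperbolicAt f x := by
  obtain ⟨z, w, hzw⟩ := exists_eigenvaluesAt_eq_pair hE f x
  obtain ⟨hsum, hprod⟩ := (eigenvaluesAt_eq_pair_iff hE).1 hzw
  have hre : z.re * w.re ≠ 0 := by
    rcases hdet.lt_or_gt with hneg | hpos
    · exact (re_mul_re_neg (by simp [hsum]) hprod hneg).ne
    · exact (re_mul_re_pos (by simp [hsum]) (by simpa [hsum]) hprod hpos).ne'
  rw [IsHyperbolicAt, hzw]
  simpa using mul_ne_zero_iff.1 hre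

include hE in
theorem stableIndex_of_det_neg (hdet : (fderiv ℝ f x).det < 0) : stableIndex f x = 1 := by
  obtain ⟨z, w, hzw⟩ := exists_eigenvaluesAt_eq_pair hE f x
  obtain ⟨hsum, hprod⟩ := (eigenvaluesAt_eq_pair_iff hE).1 hzw
  rw [stableIndex_of_eigenvaluesAt_eq_pair hzw]
  rcases mul_neg_iff.1 (re_mul_re_neg (by simp [hsum]) hprod hdet) with ⟨hz, hw⟩ | ⟨hz, hw⟩
  · rw [if_neg hz.not_gt, if_pos hw]
  · rw [if_pos hz, if_neg hw.not_gt]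

include hE in
theorem stableIndex_of_det_pos (hdet : 0 < (fderiv ℝ f x).det)
    (htrace : LinearMap.trace ℝ E (fderiv ℝ f x) ≠ 0) :
    stableIndex f x = if LinearMap.trace ℝ E (fderiv ℝ f x) < 0 then 2 else 0 := by
  obtain ⟨z, w, hzw⟩ := exists_eigenvaluesAt_eq_pair hE f x
  obtain ⟨hsum, hprod⟩ := (eigenvaluesAt_eq_pair_iff hE).1 hzw
  have hre : z.re + w.re = LinearMap.trace ℝ E (fderiv ℝ f x) := by
    simpa using congrArg Complex.re hsum
  rw [stableIndex_of_eigenvaluesAt_eq_pair hzw, ← hre]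
  rcases mul_pos_iff.1 (re_mul_re_pos (by simp [hsum]) (by simpa [hsum]) hprod hdet) with
    ⟨hz, hw⟩ | ⟨hz, hw⟩
  · rw [if_neg hz.not_gt, if_neg hw.not_gt, if_neg (add_pos hz hw).not_gt]
  · rw [if_pos hz, if_pos hw, if_pos (add_neg hz hw)]

end PlanarLinearization

/-! ### Exchange of stability -/

theorem eventually_mul_pos_of_hasDerivAt {f : ℝ → ℝ} {d s₀ : ℝ} (hf : HasDerivAt f d s₀)
    (hf₀ : f s₀ = 0) (hd : d ≠ 0) : ∀ᶠ s in 𝓝[≠] s₀, 0 < f s * (d * (s - s₀)) := by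
  have hslope : Tendsto (fun s => slope f s₀ s * d) (𝓝[≠] s₀) (𝓝 (d * d)) :=
    hf.tendsto_slope.mul_const d
  filter_upwards [hslope.eventually_const_lt (mul_self_pos.2 hd), self_mem_nhdsWithin]
    with s hs hne
  have hfs : slope f s₀ s * (s - s₀) = f s := by
    rw [slope_def_field, hf₀, sub_zero, div_mul_cancel₀ _ (sub_ne_zero.2 hne)]
  calc 0 < slope f s₀ s * d * ((s - s₀) * (s - s₀)) :=
        mul_pos hs (mul_self_pos.2 (sub_ne_zero.2 hne))
    _ = f s * (d * (s - s₀)) := by rw [← hfs]; ring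

theorem exists_exchange_of_mul_neg {i j : ℝ → ℕ} {m : ℕ} {s₀ ρ a b : ℝ} (hm : m = 0 ∨ m = 2)
    (hab : a * b < 0)
    (hi : ∀ s ∈ Set.Ioo (s₀ - ρ) (s₀ + ρ), s ≠ s₀ → i s = if a * (s - s₀) < 0 then 1 else m)
    (hj : ∀ s ∈ Set.Ioo (s₀ - ρ) (s₀ + ρ), s ≠ s₀ → j s = if b * (s - s₀) < 0 then 1 else m) :
    ∃ k l : ℕ, (k = l + 1 ∨ l = k + 1) ∧
      (∀ s ∈ Set.Ioo (s₀ - ρ) s₀, i s = k ∧ j s = l) ∧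
      (∀ s ∈ Set.Ioo s₀ (s₀ + ρ), i s = l ∧ j s = k) := by
  refine ⟨if 0 < a then 1 else m, if 0 < b then 1 else m, ?_, fun s hs => ?_, fun s hs => ?_⟩
  · rcases mul_neg_iff.1 hab with ⟨ha, hb⟩ | ⟨ha, hb⟩
    · rw [if_pos ha, if_neg hb.not_gt]
      omega
    · rw [if_neg ha.not_gt, if_pos hb]
      omega
  · have hsign : ∀ d : ℝ, d * (s - s₀) < 0 ↔ 0 < d := fun d => by
      simp [mul_neg_iff, hs.2, hs.2.not_gt]
    have hs' : s ∈ Set.Ioo (s₀ - ρ) (s₀ + ρ) := ⟨hs.1, by linarith [hs.1, hs.2]⟩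
    rw [hi s hs' hs.2.ne, hj s hs' hs.2.ne]
    simp only [hsign, and_self]
  · have hsign : ∀ d : ℝ, d * (s - s₀) < 0 ↔ d < 0 := fun d => by
      simp [mul_neg_iff, hs.1, hs.1.not_gt]
    have hs' : s ∈ Set.Ioo (s₀ - ρ) (s₀ + ρ) := ⟨by linarith [hs.1, hs.2], hs.2⟩
    rw [hi s hs' hs.1.ne', hj s hs' hs.1.ne']
    simp only [hsign, neg_iff_pos_of_mul_neg hab, ← pos_iff_neg_of_mul_neg hab, and_self]

section ExchangeOfStability

variable {E : Type*} [NormedAddCommGroup E] [NormedSpace ℝ E] [FiniteDimensional ℝ E]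
  (hE : Module.finrank ℝ E = 2) {F : ℝ → E → E} {p q : ℝ → E} {x₀ : E} {s₀ dp dq : ℝ}

include hE in
theorem eventually_isHyperbolicAt_and_stableIndex (hp₀ : p s₀ = x₀) (hp : ContinuousAt p s₀)
    (hcont : ContinuousAt (fun v : ℝ × E => fderiv ℝ (F v.1) v.2) (s₀, x₀))
    (htrace : LinearMap.trace ℝ E (fderiv ℝ (F s₀) x₀) ≠ 0)
    (hdet : (fderiv ℝ (F s₀) x₀).det = 0)
    (hdp : HasDerivAt (fun s => (fderiv ℝ (F s) (p s)).det) dp s₀) (hdp₀ : dp ≠ 0) :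
    ∀ᶠ s in 𝓝[≠] s₀, IsHyperbolicAt (F s) (p s) ∧ stableIndex (F s) (p s) =
      if dp * (s - s₀) < 0 then 1 else
        if LinearMap.trace ℝ E (fderiv ℝ (F s₀) x₀) < 0 then 2 else 0 := by
  subst hp₀
  have hcont_p : ContinuousAt (fun s => fderiv ℝ (F s) (p s)) s₀ :=
    hcont.comp (f := fun s => (s, p s)) (continuousAt_id.prodMk hp)
  have htrace_cont : ContinuousAt (fun s => LinearMap.trace ℝ E (fderiv ℝ (F s) (p s))) s₀ :=
    (LinearMap.continuous_of_finiteDimensional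
      (LinearMap.trace ℝ E ∘ₗ ContinuousLinearMap.coeLM ℝ)).continuousAt.comp hcont_p
  have htrace_sign : ∀ᶠ s in 𝓝 s₀, 0 < LinearMap.trace ℝ E (fderiv ℝ (F s) (p s)) *
      LinearMap.trace ℝ E (fderiv ℝ (F s₀) (p s₀)) :=
    (htrace_cont.mul_const _).eventually_const_lt (mul_self_pos.2 htrace)
  filter_upwards [eventually_mul_pos_of_hasDerivAt hdp hdet hdp₀,
    htrace_sign.filter_mono nhdsWithin_le_nhds] with s hs htr
  refine ⟨isHyperbolicAt_of_det_ne_zero hE (left_ne_zero_of_mul hs.ne')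
    (left_ne_zero_of_mul htr.ne'), ?_⟩
  rcases pos_and_pos_or_neg_and_neg_of_mul_pos hs with ⟨hpos, hd⟩ | ⟨hneg, hd⟩
  · rw [stableIndex_of_det_pos hE hpos (left_ne_zero_of_mul htr.ne'), if_neg hd.not_gt]
    exact if_congr (neg_iff_neg_of_mul_pos htr) rfl rfl
  · rw [stableIndex_of_det_neg hE hneg, if_pos hd]

include hE in
theorem isTranscritical_of_det_crossing (hp₀ : p s₀ = x₀) (hq₀ : q s₀ = x₀)
    (hp : ∀ᶠ s in 𝓝 s₀, ContDiffAt ℝ ∞ p s) (hq : ∀ᶠ s in 𝓝 s₀, ContDiffAt ℝ ∞ q s)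
    (hpq : deriv p s₀ ≠ deriv q s₀)
    (hzero : ∀ᶠ v in 𝓝 (s₀, x₀), F v.1 v.2 = 0 ↔ v.2 = p v.1 ∨ v.2 = q v.1)
    (hcont : ContinuousAt (fun v : ℝ × E => fderiv ℝ (F v.1) v.2) (s₀, x₀))
    (htrace : LinearMap.trace ℝ E (fderiv ℝ (F s₀) x₀) ≠ 0)
    (hdet : (fderiv ℝ (F s₀) x₀).det = 0)
    (hdp : HasDerivAt (fun s => (fderiv ℝ (F s) (p s)).det) dp s₀)
    (hdq : HasDerivAt (fun s => (fderiv ℝ (F s) (q s)).det) dq s₀) (hneg : dp * dq < 0) :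
    IsTranscritical F p q x₀ s₀ := by
  have hp_cont := hp.self_of_nhds.continuousAt
  have hq_cont := hq.self_of_nhds.continuousAt
  have hne : ∀ᶠ s in 𝓝[≠] s₀, p s ≠ q s :=
    ((hp.self_of_nhds.differentiableAt (by simp)).hasDerivAt.sub
      (hq.self_of_nhds.differentiableAt (by simp)).hasDerivAt).eventually_ne
      (sub_ne_zero.2 hpq) |>.mono fun s => sub_ne_zero.1
  have hp_index := eventually_isHyperbolicAt_and_stableIndex hE hp₀ hp_cont hcont
    htrace hdet hdp (left_ne_zero_of_mul hneg.ne)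
  have hq_index := eventually_isHyperbolicAt_and_stableIndex hE hq₀ hq_cont hcont
    htrace hdet hdq (right_ne_zero_of_mul hneg.ne)
  obtain ⟨r, hzero_r, hr : 0 < r⟩ :=
    ((eventually_forall_ball hzero).and self_mem_nhdsWithin).exists
  have hs₀_r : ∀ᶠ s in 𝓝 s₀, s ∈ Metric.ball s₀ r := Metric.ball_mem_nhds s₀ hr
  have hp_r : ∀ᶠ s in 𝓝 s₀, p s ∈ Metric.ball x₀ r :=
    hp_cont.eventually (hp₀ ▸ Metric.ball_mem_nhds x₀ hr)
  have hq_r : ∀ᶠ s in 𝓝 s₀, q s ∈ Metric.ball x₀ r :=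
    hq_cont.eventually (hq₀ ▸ Metric.ball_mem_nhds x₀ hr)
  obtain ⟨ρ, h, hρ⟩ := ((eventually_forall_ball (hp.and (hq.and (hs₀_r.and (hp_r.and (hq_r.and
    (eventually_nhdsWithin_iff.1 (hne.and (hp_index.and hq_index))))))))).and
    self_mem_nhdsWithin).exists
  rw [Real.ball_eq_Ioo] at h
  refine ⟨hp₀, hq₀, hpq, ρ, hρ, r, hr, fun s hs => (h s hs).1.contDiffWithinAt,
    fun s hs => (h s hs).2.1.contDiffWithinAt, fun s hs => ?_, ?_⟩
  · obtain ⟨-, -, hsr, hpr, hqr, hindex⟩ := h s hs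
    exact ⟨hpr, hqr, fun x hx => hzero_r (s, x) (ball_prod_same s₀ x₀ r ▸ ⟨hsr, hx⟩),
      fun hss₀ => ⟨(hindex hss₀).1, (hindex hss₀).2.1.1, (hindex hss₀).2.2.1⟩⟩
  · exact exists_exchange_of_mul_neg (by split_ifs <;> simp) hneg
      (fun s hs hss₀ => ((h s hs).2.2.2.2.2 hss₀).2.1.2)
      (fun s hs hss₀ => ((h s hs).2.2.2.2.2 hss₀).2.2.2)

end ExchangeOfStability

/-! ### Kolmogorov vector fields -/

theorem hasDerivAt_mul_of_eq_zero {f g : ℝ → ℝ} {g' s : ℝ} (hf : DifferentiableAt ℝ f s)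
    (hg : HasDerivAt g g' s) (hgs : g s = 0) : HasDerivAt (fun t => f t * g t) (f s * g') s :=
  (hf.hasDerivAt.mul hg).congr_deriv (by rw [hgs, mul_zero, zero_add])

theorem hasDerivAt_fst {φ : ℝ → ℝ × ℝ} {d : ℝ × ℝ} {s : ℝ} (hφ : HasDerivAt φ d s) :
    HasDerivAt (fun t => (φ t).1) d.1 s :=
  (ContinuousLinearMap.fst ℝ ℝ ℝ).hasFDerivAt.comp_hasDerivAt s hφ

theorem hasDerivAt_snd {φ : ℝ → ℝ × ℝ} {d : ℝ × ℝ} {s : ℝ} (hφ : HasDerivAt φ d s) :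
    HasDerivAt (fun t => (φ t).2) d.2 s :=
  (ContinuousLinearMap.snd ℝ ℝ ℝ).hasFDerivAt.comp_hasDerivAt s hφ

section PartialDerivatives

variable {X Y Z : Type*} [NormedAddCommGroup X] [NormedSpace ℝ X] [NormedAddCommGroup Y]
  [NormedSpace ℝ Y] [NormedAddCommGroup Z] [NormedSpace ℝ Z] {f : X → Y → Z} {x : X} {y : Y}

theorem hasFDerivAt_curry_right (hf : DifferentiableAt ℝ (Function.uncurry f) (x, y)) :
    HasFDerivAt (f x) (fderiv ℝ (Function.uncurry f) (x, y) ∘L .inr ℝ X Y) y :=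
  hf.hasFDerivAt.comp y (hasFDerivAt_prodMk_right x y)

theorem hasDerivAt_curry_comp {f : ℝ → Y → Z} {φ : ℝ → Y} {φ' : Y} {s : ℝ}
    (hf : DifferentiableAt ℝ (Function.uncurry f) (s, φ s)) (hφ : HasDerivAt φ φ' s) :
    HasDerivAt (fun t => f t (φ t)) (fderiv ℝ (Function.uncurry f) (s, φ s) (1, φ')) s :=
  hf.hasFDerivAt.comp_hasDerivAt (f := fun t => (t, φ t)) s ((hasDerivAt_id s).prodMk hφ)

end PartialDerivatives

/-- The signed area of the parallelogram spanned by `u` and `v`, that is, the determinant of the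
matrix with columns `u` and `v`. It expresses the minors of derivatives with values in the plane. -/
def wedge (u v : ℝ × ℝ) : ℝ := u.1 * v.2 - u.2 * v.1

theorem det_eq_wedge (L : ℝ × ℝ →L[ℝ] ℝ × ℝ) : L.det = wedge (L (1, 0)) (L (0, 1)) := by
  rw [ContinuousLinearMap.det, ← LinearMap.det_toMatrix (Module.Basis.finTwoProd ℝ),
    Matrix.det_fin_two]
  simp only [LinearMap.toMatrix_apply, Module.Basis.finTwoProd_zero, Module.Basis.finTwoProd_one,
    ContinuousLinearMap.coe_coe, Module.Basis.coe_finTwoProd_repr, Matrix.cons_val_zero,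
    Matrix.cons_val_one, Matrix.cons_val_fin_one, wedge]
  ring

theorem wedge_apply_one (D : ℝ × ℝ × ℝ →L[ℝ] ℝ × ℝ) (d : ℝ × ℝ) :
    wedge (D (0, 1, 0)) (D (1, d)) =
      wedge (D (0, 1, 0)) (D (1, 0)) + d.2 * wedge (D (0, 1, 0)) (D (0, 0, 1)) := by
  have hsplit : ((1 : ℝ), d) = (1, 0) + d.1 • (0, 1, 0) + d.2 • (0, 0, 1) := by simp
  rw [hsplit, map_add, map_add, map_smul, map_smul]
  simp only [wedge, Prod.fst_add, Prod.snd_add, Prod.smul_fst, Prod.smul_snd, smul_eq_mul]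
  ring

theorem trace_prod_real (L : ℝ × ℝ →L[ℝ] ℝ × ℝ) :
    LinearMap.trace ℝ (ℝ × ℝ) L = (L (1, 0)).1 + (L (0, 1)).2 := by
  rw [LinearMap.trace_eq_matrix_trace ℝ (Module.Basis.finTwoProd ℝ), Matrix.trace_fin_two]
  simp [LinearMap.toMatrix_apply]

theorem finrank_prod_real : Module.finrank ℝ (ℝ × ℝ) = 2 := by
  simp

/-- The vector field of the Kolmogorov system `x' = x g(x)` with per capita growth rates `g`. In the
plane `A = ℝ × ℝ` the product is taken coordinatewise. -/
def kolmogorovField {A : Type*} [Mul A] (g : A → A) (x : A) : A := x * g x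

section Kolmogorov

variable {A : Type*} [NormedCommRing A] [NormedAlgebra ℝ A] {g : A → A} {x : A}

theorem fderiv_kolmogorovField (hg : DifferentiableAt ℝ g x) (v : A) :
    fderiv ℝ (kolmogorovField g) x v = x * fderiv ℝ g x v + g x * v := by
  unfold kolmogorovField
  rw [fderiv_fun_mul differentiableAt_fun_id hg]
  simp

theorem fderiv_fderiv_kolmogorovField (hg : ContDiffAt ℝ 2 g x) (v : A) :
    fderiv ℝ (fun y => fderiv ℝ (kolmogorovField g) y v) x v =
      x * fderiv ℝ (fun y => fderiv ℝ g y v) x v + 2 * (v * fderiv ℝ g x v) := by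
  have hfst : (fun y => fderiv ℝ (kolmogorovField g) y v) =ᶠ[𝓝 x]
      fun y => y * fderiv ℝ g y v + g y * v :=
    (hg.eventually (by simp)).mono fun y hy =>
      fderiv_kolmogorovField (hy.differentiableAt (by simp)) v
  have hg₁ : DifferentiableAt ℝ g x := hg.differentiableAt (by simp)
  have hg₂ : DifferentiableAt ℝ (fun y => fderiv ℝ g y v) x :=
    ((hg.fderiv_right (m := 1) (by norm_num)).differentiableAt (by simp)).clm_apply
      (differentiableAt_const v)
  rw [hfst.fderiv_eq, fderiv_fun_add (differentiableAt_fun_id.fun_mul hg₂) (hg₁.mul_const v),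
    fderiv_fun_mul differentiableAt_fun_id hg₂, fderiv_mul_const hg₁]
  simp only [fderiv_fun_id, add_apply, smul_apply, smul_eq_mul, ContinuousLinearMap.id_apply]
  ring

theorem hasDerivAt_kolmogorovField_apply {G : ℝ → A → A} {s : ℝ} {v : A}
    (hG : HasDerivAt (fun t => G t x) v s) :
    HasDerivAt (fun t => kolmogorovField (G t) x) (x * v) s :=
  hG.const_mul x

theorem deriv_fderiv_kolmogorovField {G : ℝ → A → A} {s : ℝ}
    (hG : ContDiffAt ℝ 2 (Function.uncurry G) (s, x)) (v : A) :
    deriv (fun t => fderiv ℝ (kolmogorovField (G t)) x v) s =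
      x * deriv (fun t => fderiv ℝ (G t) x v) s + deriv (fun t => G t x) s * v := by
  have hslice : ∀ᶠ t in 𝓝 s, DifferentiableAt ℝ (G t) x :=
    (((Continuous.prodMk_left x).tendsto s).eventually (hG.eventually (by simp))).mono
      fun t ht => (hasFDerivAt_curry_right (ht.differentiableAt (by simp))).differentiableAt
  have hfst : (fun t => fderiv ℝ (kolmogorovField (G t)) x v) =ᶠ[𝓝 s]
      fun t => x * fderiv ℝ (G t) x v + G t x * v :=
    hslice.mono fun t ht => fderiv_kolmogorovField ht v
  have hG₁ : DifferentiableAt ℝ (fun t => G t x) s :=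
    (hasDerivAt_curry_comp (hG.differentiableAt (by simp)) (hasDerivAt_const s x)).differentiableAt
  have hG₂ : DifferentiableAt ℝ (fun t => fderiv ℝ (G t) x v) s :=
    ((hG.fderiv contDiffAt_const (m := 1) (by norm_num)).differentiableAt (by simp)).clm_apply
      (differentiableAt_const v)
  rw [hfst.deriv_eq, deriv_fun_add (hG₂.const_mul x) (hG₁.mul_const v), deriv_const_mul x hG₂,
    deriv_mul_const hG₁]

end Kolmogorov

section PlanarKolmogorov

variable {g : ℝ × ℝ → ℝ × ℝ} {x : ℝ × ℝ} {x₀ : ℝ}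

theorem det_fderiv_kolmogorovField (hg : DifferentiableAt ℝ g x) (hgx : g x = 0) :
    (fderiv ℝ (kolmogorovField g) x).det =
      x.1 * x.2 * wedge (fderiv ℝ g x (1, 0)) (fderiv ℝ g x (0, 1)) := by
  rw [det_eq_wedge, fderiv_kolmogorovField hg, fderiv_kolmogorovField hg, hgx, wedge, wedge]
  simp only [zero_mul, add_zero, Prod.fst_mul, Prod.snd_mul]
  ring

theorem det_fderiv_kolmogorovField_axis (hg : DifferentiableAt ℝ g (x₀, 0))
    (hgx : (g (x₀, 0)).1 = 0) :
    (fderiv ℝ (kolmogorovField g) (x₀, 0)).det =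
      x₀ * (fderiv ℝ g (x₀, 0) (1, 0)).1 * (g (x₀, 0)).2 := by
  rw [det_eq_wedge, fderiv_kolmogorovField hg, fderiv_kolmogorovField hg, wedge]
  simp [hgx]

theorem trace_fderiv_kolmogorovField_axis (hg : DifferentiableAt ℝ g (x₀, 0))
    (hgx : g (x₀, 0) = 0) :
    LinearMap.trace ℝ (ℝ × ℝ) (fderiv ℝ (kolmogorovField g) (x₀, 0)) =
      x₀ * (fderiv ℝ g (x₀, 0) (1, 0)).1 := by
  rw [trace_prod_real, fderiv_kolmogorovField hg, fderiv_kolmogorovField hg]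
  simp [hgx]

theorem eigenvaluesAt_kolmogorovField_axis (hg : DifferentiableAt ℝ g (x₀, 0))
    (hgx : g (x₀, 0) = 0) :
    eigenvaluesAt (kolmogorovField g) (x₀, 0) =
      {0, ((x₀ * (fderiv ℝ g (x₀, 0) (1, 0)).1 : ℝ) : ℂ)} := by
  rw [eigenvaluesAt_eq_pair_iff finrank_prod_real, trace_fderiv_kolmogorovField_axis hg hgx,
    det_fderiv_kolmogorovField hg hgx]
  simp

end PlanarKolmogorov

/-! ### Equilibria crossing on an axis -/

/-- The growth rates `G s` have an axial crossing at `(s₀, x₀)`, where the total derivative of `G`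
is `D`: the point `(x₀, 0)`, `x₀ ≠ 0`, is a common zero of the two rates for `s = s₀`, and the
minors of `D` that control the branches of equilibria through it do not vanish. -/
structure IsAxialCrossing (G : ℝ → ℝ × ℝ → ℝ × ℝ) (D : ℝ × ℝ × ℝ →L[ℝ] ℝ × ℝ) (s₀ x₀ : ℝ) :
    Prop where
  contDiffAt : ContDiffAt ℝ 2 (Function.uncurry G) (s₀, x₀, 0)
  hasFDerivAt : HasFDerivAt (Function.uncurry G) D (s₀, x₀, 0)
  apply_eq_zero : G s₀ (x₀, 0) = 0
  ne_zero : x₀ ≠ 0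
  fst_ne_zero : (D (0, 1, 0)).1 ≠ 0
  wedge_ne_zero : wedge (D (0, 1, 0)) (D (0, 0, 1)) ≠ 0
  wedge_param_ne_zero : wedge (D (0, 1, 0)) (D (1, 0)) ≠ 0

namespace IsAxialCrossing

variable {G : ℝ → ℝ × ℝ → ℝ × ℝ} {D : ℝ × ℝ × ℝ →L[ℝ] ℝ × ℝ} {s₀ x₀ : ℝ}
  (h : IsAxialCrossing G D s₀ x₀)

include h

theorem differentiableAt_slice : DifferentiableAt ℝ (G s₀) (x₀, 0) :=
  (hasFDerivAt_curry_right h.hasFDerivAt.differentiableAt).differentiableAt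

theorem fderiv_slice (v : ℝ × ℝ) : fderiv ℝ (G s₀) (x₀, 0) v = D (0, v) := by
  rw [(hasFDerivAt_curry_right h.hasFDerivAt.differentiableAt).fderiv, h.hasFDerivAt.fderiv]
  rfl

theorem hasDerivAt_param : HasDerivAt (fun s => G s (x₀, 0)) (D (1, 0)) s₀ :=
  h.hasFDerivAt.fderiv ▸
    hasDerivAt_curry_comp h.hasFDerivAt.differentiableAt (hasDerivAt_const s₀ (x₀, (0 : ℝ)))

theorem eventually_differentiableAt :
    ∀ᶠ w in 𝓝 (s₀, x₀, (0 : ℝ)), DifferentiableAt ℝ (G w.1) w.2 :=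
  (h.contDiffAt.eventually (by simp)).mono fun _ hw =>
    (hasFDerivAt_curry_right (hw.differentiableAt (by simp))).differentiableAt

theorem eigenvaluesAt_eq :
    eigenvaluesAt (kolmogorovField (G s₀)) (x₀, 0) = {0, ((x₀ * (D (0, 1, 0)).1 : ℝ) : ℂ)} := by
  rw [eigenvaluesAt_kolmogorovField_axis h.differentiableAt_slice h.apply_eq_zero, h.fderiv_slice]

theorem sotomayorTranscritical (hparam : (D (1, 0)).2 ≠ 0) :
    SotomayorTranscritical (fun s => kolmogorovField (G s)) (x₀, 0) s₀ := by
  set v : ℝ × ℝ := (-(D (0, 0, 1)).1, (D (0, 1, 0)).1) with hv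
  have hDv : D (0, v) = (0, wedge (D (0, 1, 0)) (D (0, 0, 1))) := by
    have hsplit : ((0 : ℝ), v) = v.1 • (0, 1, 0) + v.2 • (0, 0, 1) := by simp
    rw [hsplit, map_add, map_smul, map_smul, wedge]
    ext <;>
      simp only [hv, neg_smul, Prod.fst_add, Prod.snd_add, Prod.fst_neg, Prod.snd_neg,
        Prod.smul_fst, Prod.smul_snd, smul_eq_mul] <;>
      ring
  have hcomp (u : ℝ × ℝ) : (fderiv ℝ (kolmogorovField (G s₀)) (x₀, 0) u).2 = 0 := by
    simp [fderiv_kolmogorovField h.differentiableAt_slice, h.apply_eq_zero]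
  refine ⟨by simp [kolmogorovField, h.apply_eq_zero], ?_, ?_, v, .snd ℝ ℝ ℝ, ?_, ?_, ?_, ?_, ?_,
    ?_, ?_⟩
  · rw [h.eigenvaluesAt_eq]
    simp [h.ne_zero, h.fst_ne_zero]
  · rw [h.eigenvaluesAt_eq]
    simp [h.ne_zero, h.fst_ne_zero]
  · exact fun hv₀ => h.fst_ne_zero (congrArg Prod.snd hv₀)
  · exact fun hsnd => one_ne_zero (α := ℝ) (congrArg (fun w => w (0, 1)) hsnd)
  · rw [fderiv_kolmogorovField h.differentiableAt_slice, h.fderiv_slice, hDv, h.apply_eq_zero]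
    simp
  · exact ContinuousLinearMap.ext hcomp
  · rw [(hasDerivAt_kolmogorovField_apply h.hasDerivAt_param).deriv]
    simp
  · rw [deriv_fderiv_kolmogorovField h.contDiffAt, h.hasDerivAt_param.deriv]
    simpa using ⟨hparam, h.fst_ne_zero⟩
  · have hslice : ContDiffAt ℝ 2 (G s₀) (x₀, 0) :=
      h.contDiffAt.comp (x₀, (0 : ℝ)) (contDiffAt_const.prodMk contDiffAt_id)
    rw [fderiv_fderiv_kolmogorovField hslice, h.fderiv_slice, hDv]
    simpa using ⟨h.fst_ne_zero, h.wedge_ne_zero⟩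

theorem continuousAt_fderiv_kolmogorovField :
    ContinuousAt (fun v : ℝ × ℝ × ℝ => fderiv ℝ (kolmogorovField (G v.1)) v.2) (s₀, x₀, 0) := by
  have hG : ContDiffAt ℝ 2 (fun w : (ℝ × ℝ × ℝ) × ℝ × ℝ => G w.1.1 w.2) ((s₀, x₀, 0), x₀, 0) :=
    h.contDiffAt.comp (f := fun w : (ℝ × ℝ × ℝ) × ℝ × ℝ => (w.1.1, w.2)) ((s₀, x₀, 0), x₀, 0)
      (by fun_prop)
  exact (ContDiffAt.fderiv (m := 1) (g := Prod.snd) (contDiffAt_snd.mul hG) contDiffAt_snd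
    (by norm_num)).continuousAt

section Branches

variable {e : ℝ → ℝ} {q : ℝ → ℝ × ℝ}

theorem differentiableAt_fderiv_comp {φ : ℝ → ℝ × ℝ} (hφ : ContDiffAt ℝ ∞ φ s₀)
    (hφ₀ : φ s₀ = (x₀, 0)) (v : ℝ × ℝ) :
    DifferentiableAt ℝ (fun s => fderiv ℝ (G s) (φ s) v) s₀ := by
  have hG : ContDiffAt ℝ 2 (Function.uncurry G) (s₀, φ s₀) := hφ₀ ▸ h.contDiffAt
  exact ((hG.fderiv (m := 1) (hφ.of_le (by simp)) (by norm_num)).differentiableAt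
    (by simp)).clm_apply (differentiableAt_const v)

theorem hasDerivAt_det_axial
    (he : IsSmoothImplicitAt (fun v : ℝ × ℝ => (G v.1 (v.2, 0)).1) e (s₀, x₀)) :
    HasDerivAt (fun s => (fderiv ℝ (kolmogorovField (G s)) (e s, 0)).det)
      (x₀ * wedge (D (0, 1, 0)) (D (1, 0))) s₀ := by
  have he₀ : e s₀ = x₀ := he.base
  have hφ : ContDiffAt ℝ ∞ (fun s => (e s, (0 : ℝ))) s₀ :=
    he.contDiffAt.self_of_nhds.prodMk contDiffAt_const
  have hG : HasFDerivAt (Function.uncurry G) D (s₀, e s₀, 0) := he₀ ▸ h.hasFDerivAt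
  have hrate : HasDerivAt (fun s => G s (e s, 0)) (D (1, deriv e s₀, 0)) s₀ :=
    hG.fderiv ▸ hasDerivAt_curry_comp hG.differentiableAt
      ((he.contDiffAt.self_of_nhds.differentiableAt (by simp)).hasDerivAt.prodMk
        (hasDerivAt_const s₀ (0 : ℝ)))
  have hrate₀ : (D (1, deriv e s₀, 0)).1 = 0 :=
    (hasDerivAt_fst hrate).unique
      ((hasDerivAt_const s₀ 0).congr_of_eventuallyEq he.eventually_apply_graph)
  have hcoeff : DifferentiableAt ℝ (fun s => e s * (fderiv ℝ (G s) (e s, 0) (1, 0)).1) s₀ :=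
    (hφ.fst.differentiableAt (by simp)).mul
      (h.differentiableAt_fderiv_comp hφ (by rw [he₀]) (1, 0)).fst
  have hdet : (fun s => (fderiv ℝ (kolmogorovField (G s)) (e s, 0)).det) =ᶠ[𝓝 s₀] fun s =>
      e s * (fderiv ℝ (G s) (e s, 0) (1, 0)).1 * (G s (e s, 0)).2 := by
    have hgraph : Tendsto (fun s => (s, e s, (0 : ℝ))) (𝓝 s₀) (𝓝 (s₀, x₀, 0)) :=
      he₀ ▸ continuousAt_id.prodMk hφ.continuousAt
    filter_upwards [he.eventually_apply_graph, hgraph.eventually h.eventually_differentiableAt]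
      with s hs hdiff
    exact det_fderiv_kolmogorovField_axis hdiff hs
  refine HasDerivAt.congr_of_eventuallyEq ?_ hdet
  refine (hasDerivAt_mul_of_eq_zero hcoeff (hasDerivAt_snd hrate)
    (by rw [he₀, h.apply_eq_zero, Prod.snd_zero])).congr_deriv ?_
  have hwedge := wedge_apply_one D (deriv e s₀, 0)
  rw [wedge, hrate₀] at hwedge
  rw [he₀, h.fderiv_slice]
  linear_combination x₀ * hwedge

theorem wedge_mul_deriv_interior_snd
    (hq : IsSmoothImplicitAt (Function.uncurry G) q (s₀, x₀, 0)) :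
    wedge (D (0, 1, 0)) (D (0, 0, 1)) * (deriv q s₀).2 = -wedge (D (0, 1, 0)) (D (1, 0)) := by
  have hwedge := wedge_apply_one D (deriv q s₀)
  rw [hq.apply_one_deriv h.hasFDerivAt, wedge] at hwedge
  simp only [Prod.fst_zero, Prod.snd_zero] at hwedge
  linear_combination -hwedge

theorem hasDerivAt_det_interior
    (hq : IsSmoothImplicitAt (Function.uncurry G) q (s₀, x₀, 0)) :
    HasDerivAt (fun s => (fderiv ℝ (kolmogorovField (G s)) (q s)).det)
      (-(x₀ * wedge (D (0, 1, 0)) (D (1, 0)))) s₀ := by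
  have hq₀ : q s₀ = (x₀, 0) := hq.base
  have hq' : ContDiffAt ℝ ∞ q s₀ := hq.contDiffAt.self_of_nhds
  have hderiv : HasDerivAt q (deriv q s₀) s₀ := (hq'.differentiableAt (by simp)).hasDerivAt
  have hcoeff : DifferentiableAt ℝ (fun s => (q s).1 *
      wedge (fderiv ℝ (G s) (q s) (1, 0)) (fderiv ℝ (G s) (q s) (0, 1))) s₀ := by
    have h₁ := h.differentiableAt_fderiv_comp hq' hq₀ (1, 0)
    have h₂ := h.differentiableAt_fderiv_comp hq' hq₀ (0, 1)
    exact hderiv.differentiableAt.fst.mul ((h₁.fst.mul h₂.snd).sub (h₁.snd.mul h₂.fst))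
  have hdet : (fun s => (fderiv ℝ (kolmogorovField (G s)) (q s)).det) =ᶠ[𝓝 s₀] fun s =>
      (q s).1 * wedge (fderiv ℝ (G s) (q s) (1, 0)) (fderiv ℝ (G s) (q s) (0, 1)) * (q s).2 := by
    filter_upwards [hq.eventually_apply_graph,
      hq.tendsto_graph.eventually h.eventually_differentiableAt] with s hs hdiff
    rw [det_fderiv_kolmogorovField hdiff hs, mul_right_comm]
  refine HasDerivAt.congr_of_eventuallyEq ?_ hdet
  refine (hasDerivAt_mul_of_eq_zero hcoeff (hasDerivAt_snd hderiv)
    (by rw [hq₀])).congr_deriv ?_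
  rw [hq₀, h.fderiv_slice, h.fderiv_slice]
  linear_combination x₀ * h.wedge_mul_deriv_interior_snd hq

theorem eventually_kolmogorovField_eq_zero_iff
    (he : IsSmoothImplicitAt (fun v : ℝ × ℝ => (G v.1 (v.2, 0)).1) e (s₀, x₀))
    (hq : IsSmoothImplicitAt (Function.uncurry G) q (s₀, x₀, 0)) :
    ∀ᶠ v in 𝓝 (s₀, x₀, (0 : ℝ)),
      kolmogorovField (G v.1) v.2 = 0 ↔ v.2 = (e v.1, 0) ∨ v.2 = q v.1 := by
  have hfst : ∀ᶠ v : ℝ × ℝ × ℝ in 𝓝 (s₀, x₀, 0), v.2.1 ≠ 0 :=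
    ContinuousAt.eventually_ne (by fun_prop) h.ne_zero
  have hproj : Tendsto (fun v : ℝ × ℝ × ℝ => (v.1, v.2.1)) (𝓝 (s₀, x₀, 0)) (𝓝 (s₀, x₀)) :=
    Continuous.tendsto (by fun_prop) (s₀, x₀, (0 : ℝ))
  filter_upwards [hfst, hproj.eventually he.eq_zero_iff, hq.eq_zero_iff] with ⟨s, x, y⟩ hx hes hqs
  change kolmogorovField (G s) (x, y) = 0 ↔ (x, y) = (e s, 0) ∨ (x, y) = q s
  change G s (x, y) = 0 ↔ (x, y) = q s at hqs
  change (G s (x, 0)).1 = 0 ↔ x = e s at hes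
  have hzero : kolmogorovField (G s) (x, y) = 0 ↔
      (G s (x, y)).1 = 0 ∧ (y = 0 ∨ (G s (x, y)).2 = 0) := by
    simp [kolmogorovField, Prod.ext_iff, show x ≠ 0 from hx]
  rw [hzero, Prod.mk_inj, ← hes, ← hqs, and_or_left, Prod.ext_iff]
  refine or_congr_left (and_congr_left ?_)
  rintro rfl
  rfl

theorem isTranscritical
    (he : IsSmoothImplicitAt (fun v : ℝ × ℝ => (G v.1 (v.2, 0)).1) e (s₀, x₀))
    (hq : IsSmoothImplicitAt (Function.uncurry G) q (s₀, x₀, 0)) :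
    IsTranscritical (fun s => kolmogorovField (G s)) (fun s => (e s, 0)) q (x₀, 0) s₀ := by
  have hT : x₀ * wedge (D (0, 1, 0)) (D (1, 0)) ≠ 0 := mul_ne_zero h.ne_zero h.wedge_param_ne_zero
  have htransversal : deriv (fun s => (e s, (0 : ℝ))) s₀ ≠ deriv q s₀ := by
    have hq_snd : (deriv q s₀).2 ≠ 0 := fun h₀ => h.wedge_param_ne_zero
      (neg_eq_zero.1 (by rw [← h.wedge_mul_deriv_interior_snd hq, h₀, mul_zero]))
    rw [((he.contDiffAt.self_of_nhds.differentiableAt (by simp)).hasDerivAt.prodMk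
      (hasDerivAt_const s₀ (0 : ℝ))).deriv]
    exact fun heq => hq_snd (congrArg Prod.snd heq).symm
  refine isTranscritical_of_det_crossing finrank_prod_real (Prod.ext he.base rfl) hq.base
    (he.contDiffAt.mono fun s hs => hs.prodMk contDiffAt_const) hq.contDiffAt htransversal
    (h.eventually_kolmogorovField_eq_zero_iff he hq) h.continuousAt_fderiv_kolmogorovField ?_ ?_
    (h.hasDerivAt_det_axial he) (h.hasDerivAt_det_interior hq) ?_
  · rw [trace_fderiv_kolmogorovField_axis h.differentiableAt_slice h.apply_eq_zero, h.fderiv_slice]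
    exact mul_ne_zero h.ne_zero h.fst_ne_zero
  · rw [det_fderiv_kolmogorovField h.differentiableAt_slice h.apply_eq_zero, mul_zero, zero_mul]
  · rw [mul_neg, neg_neg_iff_pos]
    exact mul_self_pos.2 hT

end Branches

end IsAxialCrossing

/-! ### Unfolding of linear growth rates -/

theorem isBigO_sub_sub_fderiv {E F : Type*} [NormedAddCommGroup E] [NormedSpace ℝ E]
    [NormedAddCommGroup F] [NormedSpace ℝ F] {f : E → F} {a : E} (hf : ContDiffAt ℝ 2 f a) :
    (fun x => f x - f a - fderiv ℝ f a (x - a)) =O[𝓝 a] fun x => ‖x - a‖ ^ 2 := by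
  have hderiv : (fun x => fderiv ℝ f x - fderiv ℝ f a) =O[𝓝 a] fun x => x - a :=
    ((hf.fderiv_right (m := 1) (by norm_num)).differentiableAt one_ne_zero).isBigO_sub
  obtain ⟨C, hC⟩ := hderiv.bound
  obtain ⟨r, hr, hball⟩ := Metric.eventually_nhds_iff_ball.1
    (hC.and ((hf.eventually (by simp)).mono fun x hx => hx.differentiableAt (by simp)))
  refine Asymptotics.IsBigO.of_bound (|C|) ?_
  filter_upwards [Metric.ball_mem_nhds a hr] with x hx
  have hsub : ∀ y ∈ Metric.closedBall a ‖x - a‖, y ∈ Metric.ball a r := fun y hy =>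
    Metric.closedBall_subset_ball (by rwa [← dist_eq_norm]) hy
  have hbound : ∀ y ∈ Metric.closedBall a ‖x - a‖,
      ‖fderiv ℝ f y - fderiv ℝ f a‖ ≤ |C| * ‖x - a‖ := fun y hy =>
    ((hball y (hsub y hy)).1).trans (mul_le_mul (le_abs_self C) (mem_closedBall_iff_norm.1 hy)
      (norm_nonneg _) (abs_nonneg C))
  calc ‖f x - f a - fderiv ℝ f a (x - a)‖
      ≤ |C| * ‖x - a‖ * ‖x - a‖ :=
        (convex_closedBall a ‖x - a‖).norm_image_sub_le_of_norm_fderiv_le'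
          (fun y hy => (hball y (hsub y hy)).2) hbound
          (Metric.mem_closedBall_self (norm_nonneg _)) (mem_closedBall_iff_norm.2 le_rfl)
    _ = |C| * ‖‖x - a‖ ^ 2‖ := by rw [norm_pow, norm_norm]; ring

theorem isBigO_sub_mul_of_hasDerivAt {f : ℝ → ℝ} {d : ℝ} (hf : ContDiffAt ℝ 2 f 0) (hf₀ : f 0 = 0)
    (hd : HasDerivAt f d 0) : (fun t => f t - d * t) =O[𝓝 0] fun t => t ^ 2 := by
  simpa [hf₀, hd.hasFDerivAt.fderiv, mul_comm] using isBigO_sub_sub_fderiv hf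

/-- The growth rates `G μ` unfold, near the origin, the linear rates
`(μ₁ - θ ξ₁ + γ ξ₂, μ₂ - δ ξ₁ + ξ₂)`. -/
structure IsUnfolding (G : ℝ × ℝ → ℝ × ℝ → ℝ × ℝ) (θ γ δ : ℝ) : Prop where
  contDiffAt : ∀ᶠ v in 𝓝 0, ContDiffAt ℝ ∞ (Function.uncurry G) v
  apply_eq_zero : G 0 0 = 0
  fderiv_apply : ∀ μ ξ : ℝ × ℝ, fderiv ℝ (Function.uncurry G) 0 (μ, ξ) =
    (μ.1 - θ * ξ.1 + γ * ξ.2, μ.2 - δ * ξ.1 + ξ.2)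

/-- The map sending `(t, (m, x))` to the parameter `μ = (t, m)` and the state `ξ = (x, 0)`. Its
composite with the growth rates vanishes where `E₁` and `E₃` meet, and is solved for `(m, x)`. -/
def collisionMap : ℝ × ℝ × ℝ →L[ℝ] (ℝ × ℝ) × ℝ × ℝ :=
  (ContinuousLinearMap.id ℝ (ℝ × ℝ)).prodMap (.inl ℝ ℝ ℝ) ∘L
    (ContinuousLinearEquiv.prodAssoc ℝ ℝ ℝ ℝ).symm

theorem collisionMap_apply (v : ℝ × ℝ × ℝ) : collisionMap v = ((v.1, v.2.1), (v.2.2, 0)) := rfl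

namespace IsUnfolding

variable {G : ℝ × ℝ → ℝ × ℝ → ℝ × ℝ} {θ γ δ : ℝ} (h : IsUnfolding G θ γ δ)

include h

theorem hasFDerivAt_comp {E : Type*} [NormedAddCommGroup E] [NormedSpace ℝ E]
    (L : E →L[ℝ] (ℝ × ℝ) × ℝ × ℝ) :
    HasFDerivAt (fun v => G (L v).1 (L v).2) (fderiv ℝ (Function.uncurry G) 0 ∘L L) 0 := by
  have hG : HasFDerivAt (Function.uncurry G) (fderiv ℝ (Function.uncurry G) 0) (L 0) :=
    (map_zero L).symm ▸ (h.contDiffAt.self_of_nhds.differentiableAt (by simp)).hasFDerivAt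
  exact hG.comp 0 L.hasFDerivAt

theorem eventually_contDiffAt_comp {E : Type*} [NormedAddCommGroup E] [NormedSpace ℝ E]
    (L : E →L[ℝ] (ℝ × ℝ) × ℝ × ℝ) :
    ∀ᶠ v in 𝓝 0, ContDiffAt ℝ ∞ (fun v => G (L v).1 (L v).2) v := by
  have hL : Tendsto L (𝓝 0) (𝓝 0) := by simpa using L.continuous.tendsto 0
  exact (hL.eventually h.contDiffAt).mono fun v hv => hv.comp v L.contDiff.contDiffAt

theorem exists_axial (hθ : θ ≠ 0) :
    ∃ e, IsSmoothImplicitAt (fun v : (ℝ × ℝ) × ℝ => (G v.1 (v.2, 0)).1) e 0 := by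
  let L : (ℝ × ℝ) × ℝ →L[ℝ] (ℝ × ℝ) × ℝ × ℝ :=
    (ContinuousLinearMap.id ℝ (ℝ × ℝ)).prodMap (.inl ℝ ℝ ℝ)
  have hderiv : HasFDerivAt (fun v : (ℝ × ℝ) × ℝ => (G v.1 (v.2, 0)).1) _ 0 :=
    (h.hasFDerivAt_comp L).fst
  refine exists_isSmoothImplicitAt
    ((h.eventually_contDiffAt_comp L).mono fun v hv => hv.fst)
    (congrArg Prod.fst h.apply_eq_zero) (isInvertible_of_injective ?_)
  rw [injective_iff_map_eq_zero, hderiv.fderiv]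
  intro x hx
  simpa [L, h.fderiv_apply, hθ] using hx

theorem exists_interior (hθγδ : θ - γ * δ ≠ 0) :
    ∃ E₃, IsSmoothImplicitAt (Function.uncurry G) E₃ 0 := by
  refine exists_isSmoothImplicitAt h.contDiffAt h.apply_eq_zero (isInvertible_of_injective ?_)
  rw [injective_iff_map_eq_zero]
  rintro ⟨x, y⟩ hxy
  obtain ⟨h₁, h₂⟩ : -(θ * x) + γ * y = 0 ∧ -(δ * x) + y = 0 := by
    simpa [h.fderiv_apply] using hxy
  have hx : x = 0 := by
    rw [← mul_eq_zero_iff_left hθγδ]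
    linear_combination -h₁ + γ * h₂
  simpa [hx] using h₂

theorem hasFDerivAt_collision :
    HasFDerivAt (fun v : ℝ × ℝ × ℝ => G (v.1, v.2.1) (v.2.2, 0))
      (fderiv ℝ (Function.uncurry G) 0 ∘L collisionMap) 0 :=
  h.hasFDerivAt_comp collisionMap

theorem exists_collision (hθ : θ ≠ 0) :
    ∃ ψ, IsSmoothImplicitAt (fun v : ℝ × ℝ × ℝ => G (v.1, v.2.1) (v.2.2, 0)) ψ 0 := by
  refine exists_isSmoothImplicitAt (h.eventually_contDiffAt_comp collisionMap)
    h.apply_eq_zero (isInvertible_of_injective ?_)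
  rw [injective_iff_map_eq_zero, h.hasFDerivAt_collision.fderiv]
  rintro ⟨m, x⟩ hmx
  obtain ⟨hx, hm⟩ : x = 0 ∧ m - δ * x = 0 := by
    simpa [collisionMap_apply, h.fderiv_apply, hθ] using hmx
  simpa [hx] using hm

section Collision

variable {ψ : ℝ → ℝ × ℝ} (hθ : θ ≠ 0)
  (hψ : IsSmoothImplicitAt (fun v : ℝ × ℝ × ℝ => G (v.1, v.2.1) (v.2.2, 0)) ψ 0)

include hθ hψ

theorem deriv_collision : deriv ψ 0 = (δ / θ, 1 / θ) := by
  have hzero : fderiv ℝ (Function.uncurry G) 0 (collisionMap (1, deriv ψ 0)) = 0 :=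
    hψ.apply_one_deriv h.hasFDerivAt_collision
  obtain ⟨h₁, h₂⟩ : 1 - θ * (deriv ψ 0).2 = 0 ∧ (deriv ψ 0).1 - δ * (deriv ψ 0).2 = 0 := by
    simpa [collisionMap_apply, h.fderiv_apply] using hzero
  have hx : (deriv ψ 0).2 = 1 / θ := by
    rw [eq_div_iff hθ]
    linear_combination -h₁
  ext
  · rw [hx] at h₂
    linear_combination h₂
  · exact hx

theorem hasDerivAt_collision : HasDerivAt ψ (δ / θ, 1 / θ) 0 :=
  h.deriv_collision hθ hψ ▸ (hψ.contDiffAt.self_of_nhds.differentiableAt (by simp)).hasDerivAt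

theorem isBigO_collision_eigenvalue :
    (fun t => (ψ t).2 *
      (fderiv ℝ (Function.uncurry G) ((t, (ψ t).1), ((ψ t).2, 0)) (0, (1, 0))).1 + t)
      =O[𝓝 0] fun t => t ^ 2 := by
  have hψ' : ContDiffAt ℝ ∞ ψ 0 := hψ.contDiffAt.self_of_nhds
  have hψ₀ : ψ 0 = 0 := hψ.base
  have hpoint : ContDiffAt ℝ ∞ (fun t => ((t, (ψ t).1), ((ψ t).2, (0 : ℝ)))) 0 :=
    (contDiffAt_id.prodMk hψ'.fst).prodMk (hψ'.snd.prodMk contDiffAt_const)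
  have hD : ContDiffAt ℝ ∞ (fun t =>
      (fderiv ℝ (Function.uncurry G) ((t, (ψ t).1), ((ψ t).2, 0)) (0, (1, 0))).1) 0 := by
    have hG : ContDiffAt ℝ ∞ (fderiv ℝ (Function.uncurry G)) ((0, (ψ 0).1), ((ψ 0).2, 0)) := by
      rw [hψ₀]
      exact h.contDiffAt.self_of_nhds.fderiv_right (by simp)
    exact ((hG.comp (0 : ℝ) hpoint).clm_apply contDiffAt_const).fst
  have hderiv := hasDerivAt_mul_of_eq_zero (hD.differentiableAt (by simp))
    (hasDerivAt_snd (h.hasDerivAt_collision hθ hψ)) (by rw [hψ₀, Prod.snd_zero])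
  refine (isBigO_sub_mul_of_hasDerivAt ((hD.mul hψ'.snd).of_le ENat.LEInfty.out)
    (by simp [hψ₀]) hderiv).congr_left fun t => ?_
  have h₀ : (fderiv ℝ (Function.uncurry G) ((0, (ψ 0).1), ((ψ 0).2, 0)) (0, (1, 0))).1 = -θ := by
    rw [hψ₀]
    exact (congrArg Prod.fst (h.fderiv_apply 0 (1, 0))).trans (by simp)
  rw [h₀]
  field_simp
  ring

theorem isBigO_collision_curve :
    (fun t => (ψ t).1 - δ / θ * t) =O[𝓝 0] fun t => t ^ 2 :=
  isBigO_sub_mul_of_hasDerivAt (hψ.contDiffAt.self_of_nhds.fst.of_le ENat.LEInfty.out)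
    (congrArg Prod.fst hψ.base) (hasDerivAt_fst (h.hasDerivAt_collision hθ hψ))

theorem exists_collision_bound :
    ∃ K, ∀ᶠ t in 𝓝 0, |(ψ t).1 - δ / θ * t| ≤ K * t ^ 2 ∧
      |(ψ t).2 * (fderiv ℝ (Function.uncurry G) ((t, (ψ t).1), ((ψ t).2, 0)) (0, (1, 0))).1 + t|
        ≤ K * t ^ 2 := by
  obtain ⟨K, hcurve, heigenvalue⟩ :=
    ((Asymptotics.isBigO_iff_eventually.1 (h.isBigO_collision_curve hθ hψ)).and
      (Asymptotics.isBigO_iff_eventually.1 (h.isBigO_collision_eigenvalue hθ hψ))).exists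
  refine ⟨K, ?_⟩
  filter_upwards [hcurve, heigenvalue] with t h₁ h₂
  simpa using And.intro h₁ h₂

theorem eventually_collision_snd_pos :
    ∀ᶠ t in 𝓝 0, 0 < t / θ → 0 < (ψ t).2 := by
  have hsign := eventually_mul_pos_of_hasDerivAt (hasDerivAt_snd (h.hasDerivAt_collision hθ hψ))
    (congrArg Prod.snd hψ.base) (one_div_ne_zero hθ)
  filter_upwards [eventually_nhdsWithin_iff.1 hsign] with t ht htθ
  have ht₀ : t ≠ 0 := by rintro rfl; simp at htθ
  refine pos_of_mul_pos_left (ht ht₀) ?_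
  rw [sub_zero, one_div_mul_eq_div]
  exact htθ.le

end Collision

end IsUnfolding

theorem hasFDerivAt_uncurry_snd {P Q X Z : Type*} [NormedAddCommGroup P] [NormedSpace ℝ P]
    [NormedAddCommGroup Q] [NormedSpace ℝ Q] [NormedAddCommGroup X] [NormedSpace ℝ X]
    [NormedAddCommGroup Z] [NormedSpace ℝ Z] {G : P × Q → X → Z} {μ : P × Q} {ξ : X}
    (hG : DifferentiableAt ℝ (Function.uncurry G) (μ, ξ)) :
    HasFDerivAt (Function.uncurry fun s => G (μ.1, s))
      (fderiv ℝ (Function.uncurry G) (μ, ξ) ∘L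
        (ContinuousLinearMap.inr ℝ P Q).prodMap (.id ℝ X)) (μ.2, ξ) :=
  hG.hasFDerivAt.comp (f := Prod.map (Prod.mk μ.1) id) (μ.2, ξ)
    ((hasFDerivAt_prodMk_right μ.1 μ.2).prodMap (μ.2, ξ) (hasFDerivAt_id ξ))

section Coincidence

variable {G : ℝ × ℝ → ℝ × ℝ → ℝ × ℝ} {e : ℝ × ℝ → ℝ} {E₃ : ℝ × ℝ → ℝ × ℝ} {ψ : ℝ → ℝ × ℝ}

theorem eventually_interior_eq_axial
    (he : IsSmoothImplicitAt (fun v : (ℝ × ℝ) × ℝ => (G v.1 (v.2, 0)).1) e 0)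
    (hE₃ : IsSmoothImplicitAt (Function.uncurry G) E₃ 0) :
    ∀ᶠ μ in 𝓝 0, (E₃ μ).2 = 0 → E₃ μ = (e μ, 0) := by
  have hpoint : Tendsto (fun μ => (μ, (E₃ μ).1)) (𝓝 0) (𝓝 0) :=
    (((continuous_id.prodMap continuous_fst).tendsto 0).comp hE₃.tendsto_graph :)
  filter_upwards [hE₃.eventually_apply_graph, hpoint.eventually he.eq_zero_iff] with μ hμ hiff h₀
  have hE₃μ : E₃ μ = ((E₃ μ).1, 0) := Prod.ext rfl h₀
  rw [Function.uncurry_apply_pair, hE₃μ] at hμ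
  rw [hE₃μ, hiff.1 (congrArg Prod.fst hμ)]

theorem eventually_apply_collision_eq_zero
    (hψ : IsSmoothImplicitAt (fun v : ℝ × ℝ × ℝ => G (v.1, v.2.1) (v.2.2, 0)) ψ 0) :
    ∀ᶠ μ in 𝓝 (0 : ℝ × ℝ), μ.2 = (ψ μ.1).1 → G μ ((ψ μ.1).2, 0) = 0 := by
  filter_upwards [(continuous_fst.tendsto (0 : ℝ × ℝ)).eventually hψ.eventually_apply_graph]
    with μ hμ h₀
  simpa [← h₀] using hμ

theorem tendsto_collision_snd
    (hψ : IsSmoothImplicitAt (fun v : ℝ × ℝ × ℝ => G (v.1, v.2.1) (v.2.2, 0)) ψ 0) :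
    Tendsto (fun μ : ℝ × ℝ => (μ, (ψ μ.1).2)) (𝓝 0) (𝓝 0) := by
  have hψ' : ContinuousAt ψ (0 : ℝ × ℝ).1 := hψ.contDiffAt.self_of_nhds.continuousAt
  have hsnd : ContinuousAt (fun μ : ℝ × ℝ => (μ, (ψ μ.1).2)) 0 :=
    continuousAt_id.prodMk (continuousAt_snd.comp (hψ'.comp continuousAt_fst))
  rw [ContinuousAt, show ψ (0 : ℝ × ℝ).1 = 0 from hψ.base] at hsnd
  exact hsnd

theorem eventually_axial_eq_collision
    (he : IsSmoothImplicitAt (fun v : (ℝ × ℝ) × ℝ => (G v.1 (v.2, 0)).1) e 0)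
    (hψ : IsSmoothImplicitAt (fun v : ℝ × ℝ × ℝ => G (v.1, v.2.1) (v.2.2, 0)) ψ 0) :
    ∀ᶠ μ in 𝓝 (0 : ℝ × ℝ), μ.2 = (ψ μ.1).1 → e μ = (ψ μ.1).2 := by
  filter_upwards [eventually_apply_collision_eq_zero hψ,
    (tendsto_collision_snd hψ).eventually he.eq_zero_iff] with μ hμ hiff h₀
  exact (hiff.1 (congrArg Prod.fst (hμ h₀))).symm

theorem eventually_interior_snd_eq_zero_iff
    (hE₃ : IsSmoothImplicitAt (Function.uncurry G) E₃ 0)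
    (hψ : IsSmoothImplicitAt (fun v : ℝ × ℝ × ℝ => G (v.1, v.2.1) (v.2.2, 0)) ψ 0) :
    ∀ᶠ μ in 𝓝 (0 : ℝ × ℝ), (E₃ μ).2 = 0 ↔ μ.2 = (ψ μ.1).1 := by
  have hpoint : Tendsto (fun μ : ℝ × ℝ => (μ.1, μ.2, (E₃ μ).1)) (𝓝 0) (𝓝 0) :=
    ((Continuous.tendsto (by fun_prop : Continuous fun v : (ℝ × ℝ) × ℝ × ℝ =>
      (v.1.1, v.1.2, v.2.1)) 0).comp hE₃.tendsto_graph :)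
  have hzero : Tendsto (fun μ : ℝ × ℝ => (μ, ((ψ μ.1).2, (0 : ℝ)))) (𝓝 0) (𝓝 0) :=
    ((Continuous.tendsto (by fun_prop : Continuous fun v : (ℝ × ℝ) × ℝ =>
      (v.1, (v.2, (0 : ℝ)))) 0).comp (tendsto_collision_snd hψ) :)
  filter_upwards [hE₃.eventually_apply_graph, hpoint.eventually hψ.eq_zero_iff,
    eventually_apply_collision_eq_zero hψ, hzero.eventually hE₃.eq_zero_iff]
    with μ hμ hψμ hcollision hE₃μ
  constructor
  · intro h₀
    rw [Function.uncurry_apply_pair, show E₃ μ = ((E₃ μ).1, 0) from Prod.ext rfl h₀] at hμ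
    exact congrArg Prod.fst (hψμ.1 hμ)
  · intro h₀
    exact congrArg Prod.snd (hE₃μ.1 (hcollision h₀)).symm

end Coincidence

namespace IsUnfolding

variable {G : ℝ × ℝ → ℝ × ℝ → ℝ × ℝ} {θ γ δ : ℝ} {e : ℝ × ℝ → ℝ} {E₃ : ℝ × ℝ → ℝ × ℝ}
  {ψ : ℝ → ℝ × ℝ}

theorem eventually_isAxialCrossing (h : IsUnfolding G θ γ δ) (hθ : θ ≠ 0) (hθγδ : θ - γ * δ ≠ 0) :
    ∀ᶠ v in 𝓝 (0 : (ℝ × ℝ) × ℝ), G v.1 (v.2, 0) = 0 → v.2 ≠ 0 →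
      ∃ D : ℝ × ℝ × ℝ →L[ℝ] ℝ × ℝ, IsAxialCrossing (fun s => G (v.1.1, s)) D v.1.2 v.2 ∧
        (D (1, 0)).2 ≠ 0 ∧
        D (0, 1, 0) = fderiv ℝ (Function.uncurry G) (v.1, (v.2, 0)) (0, (1, 0)) := by
  let D (v : (ℝ × ℝ) × ℝ) : ℝ × ℝ × ℝ →L[ℝ] ℝ × ℝ :=
    fderiv ℝ (Function.uncurry G) (v.1, (v.2, 0)) ∘L
      (ContinuousLinearMap.inr ℝ ℝ ℝ).prodMap (.id ℝ (ℝ × ℝ))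
  have hpoint : ContinuousAt (fun v : (ℝ × ℝ) × ℝ => (v.1, (v.2, (0 : ℝ)))) 0 := by fun_prop
  have hD : ContinuousAt D 0 :=
    ((h.contDiffAt.self_of_nhds.continuousAt_fderiv (by simp)).comp_of_eq hpoint rfl).clm_comp
      continuousAt_const
  have hD₀ (s : ℝ) (ξ : ℝ × ℝ) : D 0 (s, ξ) = (-(θ * ξ.1) + γ * ξ.2, s - δ * ξ.1 + ξ.2) :=
    (h.fderiv_apply (0, s) ξ).trans (by simp)
  have hfst : ∀ᶠ v in 𝓝 0, (D v (0, 1, 0)).1 ≠ 0 :=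
    ContinuousAt.eventually_ne (by fun_prop) (by simp [hD₀, hθ])
  have hparam : ∀ᶠ v in 𝓝 0, (D v (1, 0)).2 ≠ 0 :=
    ContinuousAt.eventually_ne (by fun_prop) (by simp [hD₀])
  have hwedge : ∀ᶠ v in 𝓝 0, wedge (D v (0, 1, 0)) (D v (0, 0, 1)) ≠ 0 :=
    ContinuousAt.eventually_ne (by unfold wedge; fun_prop) (by
      simpa [hD₀, wedge] using fun heq => hθγδ (by linear_combination -heq))
  have hwedge_param : ∀ᶠ v in 𝓝 0, wedge (D v (0, 1, 0)) (D v (1, 0)) ≠ 0 :=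
    ContinuousAt.eventually_ne (by unfold wedge; fun_prop) (by simp [hD₀, wedge, hθ])
  filter_upwards [hpoint.eventually h.contDiffAt, hfst, hparam, hwedge, hwedge_param]
    with v hG hfst hparam hwedge hwedge_param hzero hne
  have hslice : ContDiffAt ℝ ∞ (fun w : ℝ × ℝ × ℝ => ((v.1.1, w.1), w.2)) (v.1.2, v.2, 0) := by
    fun_prop
  exact ⟨D v, ⟨(hG.comp (v.1.2, v.2, (0 : ℝ)) hslice).of_le ENat.LEInfty.out,
    hasFDerivAt_uncurry_snd (hG.differentiableAt (by simp)), hzero, hne, hfst, hwedge,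
    hwedge_param⟩, hparam, rfl⟩

theorem eventually_isTranscritical (h : IsUnfolding G θ γ δ) (hθ : θ ≠ 0) (hθγδ : θ - γ * δ ≠ 0)
    (he : IsSmoothImplicitAt (fun v : (ℝ × ℝ) × ℝ => (G v.1 (v.2, 0)).1) e 0)
    (hE₃ : IsSmoothImplicitAt (Function.uncurry G) E₃ 0) :
    ∀ᶠ μ in 𝓝 (0 : ℝ × ℝ), E₃ μ = (e μ, 0) → e μ ≠ 0 →
      (∃ l : ℝ, l ≠ 0 ∧
        l = e μ * (fderiv ℝ (Function.uncurry G) (μ, (e μ, 0)) (0, (1, 0))).1 ∧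
        eigenvaluesAt (kolmogorovField (G μ)) (e μ, 0) = {0, (l : ℂ)}) ∧
      SotomayorTranscritical (fun s => kolmogorovField (G (μ.1, s))) (e μ, 0) μ.2 ∧
      IsTranscritical (fun s => kolmogorovField (G (μ.1, s))) (fun s => (e (μ.1, s), 0))
        (fun s => E₃ (μ.1, s)) (e μ, 0) μ.2 := by
  filter_upwards [hE₃.eventually_apply_graph, he.eventually_isSmoothImplicitAt,
    hE₃.eventually_isSmoothImplicitAt,
    he.tendsto_graph.eventually (h.eventually_isAxialCrossing hθ hθγδ)]
    with μ hzero heμ hE₃μ hcross heq hne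
  rw [heq] at hE₃μ
  obtain ⟨D, hD, hparam, hfst⟩ := hcross (heq ▸ hzero) hne
  have hline : ContDiff ℝ ∞ fun s : ℝ => (μ.1, s) := contDiff_const.prodMk contDiff_id
  refine ⟨⟨e μ * (D (0, 1, 0)).1, mul_ne_zero hne hD.fst_ne_zero, by rw [hfst],
    hD.eigenvaluesAt_eq⟩, hD.sotomayorTranscritical hparam, ?_⟩
  exact hD.isTranscritical (IsSmoothImplicitAt.comp_left (a := fun s => (μ.1, s)) heμ hline)
    (IsSmoothImplicitAt.comp_left (a := fun s => (μ.1, s)) hE₃μ hline)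

theorem eventually_isTranscritical_of_interior_snd_eq_zero
    (h : IsUnfolding G θ γ δ) (hθ : θ ≠ 0) (hθγδ : θ - γ * δ ≠ 0) {K : ℝ}
    (he : IsSmoothImplicitAt (fun v : (ℝ × ℝ) × ℝ => (G v.1 (v.2, 0)).1) e 0)
    (hE₃ : IsSmoothImplicitAt (Function.uncurry G) E₃ 0)
    (hψ : IsSmoothImplicitAt (fun v : ℝ × ℝ × ℝ => G (v.1, v.2.1) (v.2.2, 0)) ψ 0)
    (hK : ∀ᶠ t in 𝓝 0,
      |(ψ t).2 * (fderiv ℝ (Function.uncurry G) ((t, (ψ t).1), ((ψ t).2, 0)) (0, (1, 0))).1 + t|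
        ≤ K * t ^ 2) :
    ∀ᶠ μ in 𝓝 (0 : ℝ × ℝ), (E₃ μ).2 = 0 → 0 < μ.1 / θ →
      0 < e μ ∧ E₃ μ = (e μ, 0) ∧
      (∃ l : ℝ, l ≠ 0 ∧ |l + μ.1| ≤ K * μ.1 ^ 2 ∧
        eigenvaluesAt (kolmogorovField (G μ)) (e μ, 0) = {0, (l : ℂ)}) ∧
      SotomayorTranscritical (fun s => kolmogorovField (G (μ.1, s))) (e μ, 0) μ.2 ∧
      IsTranscritical (fun s => kolmogorovField (G (μ.1, s))) (fun s => (e (μ.1, s), 0))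
        (fun s => E₃ (μ.1, s)) (e μ, 0) μ.2 := by
  have hfst : Tendsto Prod.fst (𝓝 (0 : ℝ × ℝ)) (𝓝 0) := continuous_fst.tendsto 0
  filter_upwards [hfst.eventually hK, hfst.eventually (h.eventually_collision_snd_pos hθ hψ),
    eventually_interior_snd_eq_zero_iff hE₃ hψ, eventually_axial_eq_collision he hψ,
    eventually_interior_eq_axial he hE₃, h.eventually_isTranscritical hθ hθγδ he hE₃]
    with μ hbound hpos hcurve haxial hinterior hbifurcation hsnd hsign
  have hμ : μ.2 = (ψ μ.1).1 := hcurve.1 hsnd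
  have heμ : 0 < e μ := haxial hμ ▸ hpos hsign
  rw [← hμ, ← haxial hμ] at hbound
  obtain ⟨⟨l, hl, rfl, heigenvalues⟩, hsotomayor, htranscritical⟩ :=
    hbifurcation (hinterior hsnd) heμ.ne'
  exact ⟨heμ, hinterior hsnd, ⟨_, hl, hbound, heigenvalues⟩, hsotomayor, htranscritical⟩

end IsUnfolding

namespace Coeffs

variable (c : Coeffs)

/-- The per capita growth rates `(g₁, g₂)` of the system. -/
def growth (μ ξ : ℝ × ℝ) : ℝ × ℝ := (c.g₁ μ ξ, c.g₂ μ ξ)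

variable {c}

theorem SmoothOn.contDiffAt_growth {U : Set (ℝ × ℝ)} (hc : c.SmoothOn U) {v : (ℝ × ℝ) × ℝ × ℝ}
    (hv : U ∈ 𝓝 v.1) : ContDiffAt ℝ ∞ (Function.uncurry c.growth) v := by
  have hcomp {a : ℝ × ℝ → ℝ} (ha : ContDiffOn ℝ ∞ a U) :
      ContDiffAt ℝ ∞ (fun v : (ℝ × ℝ) × ℝ × ℝ => a v.1) v :=
    (ha.contDiffAt hv).comp v contDiffAt_fst
  obtain ⟨hθ, hγ, hδ, hM, hN, hS, hP⟩ := hc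
  have hg₁ : ContDiffAt ℝ ∞ (fun v : (ℝ × ℝ) × ℝ × ℝ => c.g₁ v.1 v.2) v := by
    have := hcomp hθ
    have := hcomp hγ
    have := hcomp hM
    have := hcomp hN
    unfold g₁
    fun_prop
  have hg₂ : ContDiffAt ℝ ∞ (fun v : (ℝ × ℝ) × ℝ × ℝ => c.g₂ v.1 v.2) v := by
    have := hcomp hδ
    have := hcomp hS
    have := hcomp hP
    unfold g₂
    fun_prop
  exact hg₁.prodMk hg₂

theorem SmoothOn.fderiv_growth_zero {U : Set (ℝ × ℝ)} (hc : c.SmoothOn U) (hU : U ∈ 𝓝 0)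
    (μ ξ : ℝ × ℝ) : fderiv ℝ (Function.uncurry c.growth) 0 (μ, ξ) =
      (μ.1 - c.θ 0 * ξ.1 + c.γ 0 * ξ.2, μ.2 - c.δ 0 * ξ.1 + ξ.2) := by
  have hcoeff {a : ℝ × ℝ → ℝ} (ha : ContDiffOn ℝ ∞ a U) : HasFDerivAt
      (fun v : (ℝ × ℝ) × ℝ × ℝ => a v.1) (fderiv ℝ a 0 ∘L .fst ℝ (ℝ × ℝ) (ℝ × ℝ)) 0 :=
    ((ha.contDiffAt hU).differentiableAt (by simp)).hasFDerivAt.comp (0 : (ℝ × ℝ) × ℝ × ℝ)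
      hasFDerivAt_fst
  have hμ : HasFDerivAt (fun v : (ℝ × ℝ) × ℝ × ℝ => v.1) (.fst ℝ (ℝ × ℝ) (ℝ × ℝ)) 0 :=
    hasFDerivAt_fst
  have hξ : HasFDerivAt (fun v : (ℝ × ℝ) × ℝ × ℝ => v.2) (.snd ℝ (ℝ × ℝ) (ℝ × ℝ)) 0 :=
    hasFDerivAt_snd
  obtain ⟨hθ, hγ, hδ, hM, hN, hS, hP⟩ := hc
  have hg₁ := ((((hμ.fst.fun_sub ((hcoeff hθ).fun_mul hξ.fst)).fun_add
    ((hcoeff hγ).fun_mul hξ.snd)).fun_sub (((hcoeff hM).fun_mul hξ.fst).fun_mul hξ.snd)).fun_add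
      ((hcoeff hN).fun_mul (hξ.fst.pow 2)))
  have hg₂ := ((((hμ.snd.fun_sub ((hcoeff hδ).fun_mul hξ.fst)).fun_add hξ.snd).fun_add
    ((hcoeff hS).fun_mul (hξ.fst.pow 2))).fun_add ((hcoeff hP).fun_mul (hξ.snd.pow 2)))
  have hgrowth : HasFDerivAt (Function.uncurry c.growth) _ 0 := hg₁.prodMk hg₂
  rw [hgrowth.fderiv]
  simp

theorem SmoothOn.isUnfolding {U : Set (ℝ × ℝ)} (hc : c.SmoothOn U) (hU : U ∈ 𝓝 0) :
    IsUnfolding c.growth (c.θ 0) (c.γ 0) (c.δ 0) where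
  contDiffAt := ((continuous_fst.tendsto (0 : (ℝ × ℝ) × ℝ × ℝ)).eventually
    (eventually_mem_nhds_iff.2 hU)).mono fun v hv => hc.contDiffAt_growth hv
  apply_eq_zero := by simp [growth, g₁, g₂]
  fderiv_apply := hc.fderiv_growth_zero hU

theorem isE₁_iff {e : ℝ × ℝ → ℝ} {ε r : ℝ} :
    c.IsE₁ e ε r ↔
      IsSmoothImplicitOn (fun v : (ℝ × ℝ) × ℝ => (c.growth v.1 (v.2, 0)).1) e 0 ε r := by
  simp [IsE₁, IsSmoothImplicitOn, growth, g₁, Real.ball_eq_Ioo]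

theorem isE₃_iff {E₃ : ℝ × ℝ → ℝ × ℝ} {ε r : ℝ} :
    c.IsE₃ E₃ ε r ↔ IsSmoothImplicitOn (Function.uncurry c.growth) E₃ 0 ε r := by
  simp [IsE₃, IsSmoothImplicitOn, growth, Prod.ext_iff]

end Coeffs

end KolmogorovTranscritical

open KolmogorovTranscritical Filter in
open scoped ContDiff Topology in
theorem mainTheorem2_general {G : ℝ × ℝ → ℝ × ℝ → ℝ × ℝ} {θ γ δ : ℝ} {U : Set (ℝ × ℝ)}
    (hG : IsUnfolding G θ γ δ) (hθ : θ ≠ 0) (hθγδ : θ - γ * δ ≠ 0) (hU : U ∈ 𝓝 0) :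
    ∃ ε > 0, ∃ r > 0, ∃ (e : ℝ × ℝ → ℝ) (E₃ : ℝ × ℝ → ℝ × ℝ) (h : ℝ → ℝ) (K : ℝ),
      Metric.ball (0 : ℝ × ℝ) ε ⊆ U ∧
      IsSmoothImplicitOn (fun v : (ℝ × ℝ) × ℝ => (G v.1 (v.2, 0)).1) e 0 ε r ∧
      IsSmoothImplicitOn (Function.uncurry G) E₃ 0 ε r ∧
      ContDiffOn ℝ ∞ h (Set.Ioo (-ε) ε) ∧
      (∀ t ∈ Set.Ioo (-ε) ε, |h t - δ / θ * t| ≤ K * t ^ 2) ∧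
      {μ | μ ∈ Metric.ball (0 : ℝ × ℝ) ε ∧ (E₃ μ).2 = 0 ∧ 0 < μ.1 / θ} =
        {μ | μ ∈ Metric.ball (0 : ℝ × ℝ) ε ∧ μ.2 = h μ.1 ∧ 0 < μ.1 / θ} ∧
      ∀ μ ∈ {μ | μ ∈ Metric.ball (0 : ℝ × ℝ) ε ∧ (E₃ μ).2 = 0 ∧ 0 < μ.1 / θ},
        0 < e μ ∧ E₃ μ = (e μ, 0) ∧
        (∃ l : ℝ, l ≠ 0 ∧ |l + μ.1| ≤ K * μ.1 ^ 2 ∧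
          eigenvaluesAt (kolmogorovField (G μ)) (e μ, 0) = {0, (l : ℂ)}) ∧
        SotomayorTranscritical (fun s => kolmogorovField (G (μ.1, s))) (e μ, 0) μ.2 ∧
        IsTranscritical (fun s => kolmogorovField (G (μ.1, s)))
          (fun s => (e (μ.1, s), 0)) (fun s => E₃ (μ.1, s)) (e μ, 0) μ.2 := by
  obtain ⟨e, he⟩ := hG.exists_axial hθ
  obtain ⟨E₃, hE₃⟩ := hG.exists_interior hθγδ
  obtain ⟨ψ, hψ⟩ := hG.exists_collision hθ
  obtain ⟨K, hK⟩ := hG.exists_collision_bound hθ hψ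
  have hcurve := eventually_interior_snd_eq_zero_iff hE₃ hψ
  have hbifurcation := hG.eventually_isTranscritical_of_interior_snd_eq_zero hθ hθγδ he hE₃ hψ
    (hK.mono fun _ ht => ht.2)
  obtain ⟨r, ⟨heᵣ, hE₃ᵣ⟩, hr⟩ := ((he.eventually_isSmoothImplicitOn.and
    hE₃.eventually_isSmoothImplicitOn).and self_mem_nhdsWithin).exists
  obtain ⟨ε, ⟨heε, hE₃ε⟩, ⟨hμ, ht⟩, hε⟩ := ((heᵣ.and hE₃ᵣ).and
    (((eventually_forall_ball ((eventually_mem_set.2 hU).and (hcurve.and hbifurcation))).and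
      (eventually_forall_ball (hψ.contDiffAt.and hK))).and self_mem_nhdsWithin)).exists
  simp only [Prod.fst_zero, Real.ball_eq_Ioo, zero_sub, zero_add] at ht
  refine ⟨ε, hε, r, hr, e, E₃, fun t => (ψ t).1, K, fun μ h => (hμ μ h).1, heε, hE₃ε,
    fun t h => (ht t h).1.fst.contDiffWithinAt, fun t h => (ht t h).2.1, ?_, ?_⟩
  · exact Set.ext fun μ => and_congr_right fun h => and_congr_left' (hμ μ h).2.1
  · exact fun μ ⟨h, hsnd, hsign⟩ => (hμ μ h).2.2 hsnd hsign

open KolmogorovTranscritical in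
open scoped ContDiff in
theorem mainTheorem2 (c : Coeffs) (U : Set (ℝ × ℝ)) (hU : IsOpen U) (h0 : (0 : ℝ × ℝ) ∈ U)
    (hc : c.SmoothOn U)
    (hθδ : c.θ 0 * c.δ 0 ≠ 0) (hθγδ : c.θ 0 - c.γ 0 * c.δ 0 ≠ 0) :
    ∃ ε > 0, ∃ r > 0, ∃ (e : ℝ × ℝ → ℝ) (E₃ : ℝ × ℝ → ℝ × ℝ) (h : ℝ → ℝ) (K : ℝ),
      Metric.ball (0 : ℝ × ℝ) ε ⊆ U ∧ c.IsE₁ e ε r ∧ c.IsE₃ E₃ ε r ∧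
      -- `T₁` is a smooth curve `μ₂ = (δ/θ) μ₁ + O(μ₁²)`, `μ₁/θ > 0`
      ContDiffOn ℝ ∞ h (Set.Ioo (-ε) ε) ∧
      (∀ t ∈ Set.Ioo (-ε) ε, |h t - c.δ 0 / c.θ 0 * t| ≤ K * t ^ 2) ∧
      c.T₁ E₃ ε = {μ | μ ∈ Metric.ball (0 : ℝ × ℝ) ε ∧ μ.2 = h μ.1 ∧ 0 < μ.1 / c.θ 0} ∧
      ∀ μ ∈ c.T₁ E₃ ε,
        -- `E₃` and `E₁` collide, with eigenvalues `0` and `-μ₁ + O(μ₁²) ≠ 0`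
        0 < e μ ∧ E₃ μ = (e μ, 0) ∧
        (∃ l : ℝ, l ≠ 0 ∧ |l + μ.1| ≤ K * μ.1 ^ 2 ∧
          eigenvaluesAt (c.field μ) (e μ, 0) = {0, (l : ℂ)}) ∧
        -- with `μ₁` fixed, the system has a transcritical bifurcation as `μ₂` crosses `T₁`
        SotomayorTranscritical (fun s => c.field (μ.1, s)) (e μ, 0) μ.2 ∧
        IsTranscritical (fun s => c.field (μ.1, s))
          (fun s => (e (μ.1, s), 0)) (fun s => E₃ (μ.1, s)) (e μ, 0) μ.2 := by
  obtain ⟨ε, hε, r, hr, e, E₃, h, K, hsub, he, hE₃, hrest⟩ := mainTheorem2_general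
    (hc.isUnfolding (hU.mem_nhds h0)) (left_ne_zero_of_mul hθδ) hθγδ (hU.mem_nhds h0)
  exact ⟨ε, hε, r, hr, e, E₃, h, K, hsub, Coeffs.isE₁_iff.2 he, Coeffs.isE₃_iff.2 hE₃, hrest⟩
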